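/- There is a universal constant $C>0$ such that the following holds. Let $n\ge 2$, $m\ge n-1$ and $d_1,\dots,d_m\ge 1$ be integers, and set $d:=\max_j d_j$, $N_j:=\binom{n+d_j-1}{d_j}$ and $N:=\sum_{j=1}^m N_j$. Let $C_j=(c_{j,\alpha})_{|\alpha|=d_j}$ $(1\le j\le m)$ be independent random vectors, $C_j$ with values in $\mathbb{R}^{N_j}$, and let $K,c_0>0$ be such that for every $j$: * (Sub-Gaussian) $\mathrm{Prob}(|\langle C_j,\theta\rangle|\ge t)\le 2e^{-t^2/K^2}$ for all unit vectors $\theta\in\mathbb{R}^{N_j}$ and all $t>0$; * (Small Ball) $\mathrm{Prob}(|\langle a,C_j\rangle|\le\varepsilon\|a\|_2)\le c_0\varepsilon$ for all nonzero $a\in\mathbb{R}^{N_j}$ and all $\varepsilon>0$. Let $P=(p_1,\dots,p_m)$ be the random system of homogeneous polynomials in $x=(x_1,\dots,x_n)$ given by $$p_j(x)=\sum_{|\alpha|=d_j}c_{j,\alpha}\sqrt{\tbinom{d_j}{\alpha}}\,x^\alpha .$$ For a system $P$ of real homogeneous polynomials $p_j$ of degree $d_j$, in which $b_{j,\alpha}$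 denotes the coefficient of $x^\alpha$ in $p_j$, put $\|P\|_W:=\Big(\sum_{j}\sum_{|\alpha|=d_j}|b_{j,\alpha}|^2/\binom{d_j}{\alpha}\Big)^{1/2}$. For $x\in S^{n-1}$ put $$L(P,x):=\sqrt{\sigma_{\min}\big(\Delta^{-1}DP(x)|_{T_xS^{n-1}}\big)^2+\|P(x)\|_2^2},$$ where $DP(x)$ is the Jacobian matrix, $T_xS^{n-1}=x^\perp$, $\Delta$ is the diagonal matrix with diagonal entries $\sqrt{d_1},\dots,\sqrt{d_m}$, and $\sigma_{\min}(T)$ is the smallest singular value of $T$, i.e. the square root of the smallest eigenvalue of $T^\top T$. Finally put $$\tilde\kappa(P):=\sup_{x\in S^{n-1}}\frac{\|P\|_W}{L(P,x)}\in[0,\infty],$$ the quotient being $\infty$ where $L(P,x)=0$. Write $r:=m-n+\tfrac32$, $\ell:=m\log(ed)$ and $$M:=\sqrt{\tfrac{N}{m}}\,(Kc_0C)^{\frac{m}{r}}\,\big(3d^2\log(ed)\big)^{\frac{n-3/2}{r}}\,n^{\frac{1}{2m-2n+3}}\,\max\Big\{d^6,\frac{n}{d^2}\Big\}.$$ Then: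 1. If $N\ge \ell$, then $$\mathrm{Prob}(\tilde\kappa(P)\ge tM)\le\begin{cases}\dfrac{3}{t^{r}} & \text{if } 1\le t\le e^{\ell/r},\\[2mm] \dfrac{3}{t^{r}}\Big(\dfrac{r\log t}{\ell}\Big)^{\frac{n-3/2}{2}} & \text{if } e^{\ell/r}\le t\le e^{N/r},\\[2mm] \dfrac{3}{t^{r}}\Big(\dfrac{r\log t}{N}\Big)^{\frac m2}\Big(\dfrac{N}{\ell}\Big)^{\frac{n-3/2}{2}} & \text{if } t\ge e^{N/r}.\end{cases}$$ 2. If $N\le \ell$, then $$\mathrm{Prob}(\tilde\kappa(P)\ge tM)\le\begin{cases}\dfrac{3}{t^{r}} & \text{if } 1\le t\le e^{N/r},\\[2mm] \dfrac{3}{t^{r}}\Big(\dfrac{r\log t}{N}\Big)^{\frac m2} & \text{if } t\ge e^{N/r}.\end{cases}$$ -/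

import Mathlib

open MeasureTheory ProbabilityTheory

noncomputable section

/-- The exponent vectors `α = (α₁, …, αₙ)` of natural numbers with `α₁ + ⋯ + αₙ = d`. -/
abbrev WExp (n d : ℕ) : Type :=
  {α : Fin n →₀ ℕ // α ∈ (Finset.univ : Finset (Fin n)).finsuppAntidiag d}

/-- The homogeneous polynomial `∑_{|α| = d} c_α √(d choose α) x^α` with Weyl-scaled coefficient
vector `c`. -/
def weylPoly {n d : ℕ} (c : EuclideanSpace ℝ (WExp n d)) : MvPolynomial (Fin n) ℝ :=
  ∑ α : WExp n d, MvPolynomial.monomial α.1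
    (c α * Real.sqrt (Nat.multinomial Finset.univ α.1 : ℝ))

/-- The Weyl-Bombieri norm of a homogeneous polynomial `p` of degree `d` in `n` variables. -/
def weylNorm {n : ℕ} (d : ℕ) (p : MvPolynomial (Fin n) ℝ) : ℝ :=
  Real.sqrt (∑ α : WExp n d,
    |p.coeff α.1| ^ 2 / (Nat.multinomial Finset.univ α.1 : ℝ))

/-- The Weyl-Bombieri norm of a system `P = (p₁, …, p_m)`, with `pᵢ` homogeneous of degree
`deg i`. -/
def weylNormSys {n m : ℕ} (deg : Fin m → ℕ) (P : Fin m → MvPolynomial (Fin n) ℝ) : ℝ :=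
  Real.sqrt (∑ i, weylNorm (deg i) (P i) ^ 2)

/-- The value `P(x)` of a polynomial system. -/
def evalSys {n m : ℕ} (P : Fin m → MvPolynomial (Fin n) ℝ) (x : EuclideanSpace ℝ (Fin n)) :
    EuclideanSpace ℝ (Fin m) :=
  WithLp.toLp 2 fun i => MvPolynomial.eval (fun k => x k) (P i)

/-- The `m × n` Jacobian matrix of a polynomial system at `x`. -/
def jacobianSys {n m : ℕ} (P : Fin m → MvPolynomial (Fin n) ℝ) (x : EuclideanSpace ℝ (Fin n)) :
    Matrix (Fin m) (Fin n) ℝ :=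
  Matrix.of fun i k => MvPolynomial.eval (fun l => x l) (MvPolynomial.pderiv k (P i))

/-- The tangent space `T_x S^{n-1}` at a unit vector `x`: the orthogonal complement of `x`. -/
abbrev sphereTangent {n : ℕ} (x : EuclideanSpace ℝ (Fin n)) :
    Submodule ℝ (EuclideanSpace ℝ (Fin n)) :=
  (Submodule.span ℝ {x})ᗮ

/-- The linear map `Δ⁻¹ DP(x)` restricted to `T_x S^{n-1}`, where `Δ` is the diagonal matrix with
diagonal entries `√d₁, …, √d_m`. -/
def scaledTangentMap {n m : ℕ} (deg : Fin m → ℕ) (P : Fin m → MvPolynomial (Fin n) ℝ)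
    (x : EuclideanSpace ℝ (Fin n)) : sphereTangent x →ₗ[ℝ] EuclideanSpace ℝ (Fin m) :=
  (Matrix.toEuclideanLin
    ((Matrix.diagonal fun i => Real.sqrt (deg i : ℝ))⁻¹ * jacobianSys P x)).domRestrict
      (sphereTangent x)

/-- The smallest singular value of `T : E → F`. The singular values are the square roots of the
`dim E` eigenvalues of `T* T`; Mathlib lists them in decreasing order, starting with index `0`. -/
def sigmaMin {E F : Type*} [NormedAddCommGroup E] [InnerProductSpace ℝ E] [FiniteDimensional ℝ E]
    [NormedAddCommGroup F] [InnerProductSpace ℝ F] [FiniteDimensional ℝ F]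
    (T : E →ₗ[ℝ] F) : ℝ :=
  T.singularValues (Module.finrank ℝ E - 1)

/-- `L(P, x)`, the square root of `σ_min(Δ⁻¹ DP(x)|_{T_x S^{n-1}})² + ‖P(x)‖²`. -/
def condL {n m : ℕ} (deg : Fin m → ℕ) (P : Fin m → MvPolynomial (Fin n) ℝ)
    (x : EuclideanSpace ℝ (Fin n)) : ℝ :=
  Real.sqrt (sigmaMin (scaledTangentMap deg P x) ^ 2 + ‖evalSys P x‖ ^ 2)

open Classical in
/-- The local condition number `‖P‖_W / L(P, x)`, equal to `∞` where `L(P, x) = 0`. -/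
def condLocal {n m : ℕ} (deg : Fin m → ℕ) (P : Fin m → MvPolynomial (Fin n) ℝ)
    (x : EuclideanSpace ℝ (Fin n)) : ENNReal :=
  if condL deg P x = 0 then ⊤ else ENNReal.ofReal (weylNormSys deg P / condL deg P x)

/-- The global condition number for real solving, the supremum of the local one over the unit
sphere. -/
def condGlobal {n m : ℕ} (deg : Fin m → ℕ) (P : Fin m → MvPolynomial (Fin n) ℝ) : ENNReal :=
  ⨆ x ∈ Metric.sphere (0 : EuclideanSpace ℝ (Fin n)) 1, condLocal deg P x

/-- The Sub-Gaussian assumption with constant `K` on a random vector `X`. -/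
def SubGaussianVec {Ω ι : Type*} [MeasurableSpace Ω] [Fintype ι] (μ : Measure Ω)
    (X : Ω → EuclideanSpace ℝ ι) (K : ℝ) : Prop :=
  ∀ θ : EuclideanSpace ℝ ι, ‖θ‖ = 1 → ∀ t : ℝ, 0 < t →
    μ.real {ω | t ≤ |inner ℝ (X ω) θ|} ≤ 2 * Real.exp (-t ^ 2 / K ^ 2)

/-- The Small Ball assumption with constant `c₀` on a random vector `X` (for `a = 0` the inequality
could never hold for all `ε`, so `a` is nonzero). -/
def SmallBallVec {Ω ι : Type*} [MeasurableSpace Ω] [Fintype ι] (μ : Measure Ω)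
    (X : Ω → EuclideanSpace ℝ ι) (c₀ : ℝ) : Prop :=
  ∀ a : EuclideanSpace ℝ ι, a ≠ 0 → ∀ ε : ℝ, 0 < ε →
    μ.real {ω | |inner ℝ a (X ω)| ≤ ε * ‖a‖} ≤ c₀ * ε

end

/-!
If the condition number is at least `s`, then at some point `x` of the sphere `P(x)` and one
directional derivative `DP(x) y` are small compared with `‖P‖_W / s`. Along great circles `P` is a
trigonometric polynomial, so its first two derivatives are controlled by its supremum `γ` on the
sphere. Consequently `‖P‖` remains of order `α ≈ ‖P‖_W / s` on an ellipsoid around `x` which is long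
in the direction `y`, since there the first-order term of `P` is small as well. By the small ball
property a fixed point of the sphere satisfies `‖P‖ ≲ α` with probability `O(α) ^ m`, and Fubini's
theorem turns this into a bound for the probability that some such ellipsoid exists. The
sub-Gaussian property yields tail bounds for `‖P‖_W` and for the supremum of `‖P‖`, the latter again
by Fubini, because `‖P‖` stays above `γ / 2` on a cap around a maximum. The three regimes of the
theorem come from letting both truncation levels grow with `t` only as far as necessary.
-/

section Weyl

variable {n m d : ℕ}

/-- The vector `(√(d choose α) x^α)_α` of normalized monomials of degree `d`, through which the
evaluation of `weylPoly c` at `x` becomes an inner product with the coefficient vector `c`. -/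
noncomputable def weylVec (d : ℕ) (x : EuclideanSpace ℝ (Fin n)) : EuclideanSpace ℝ (WExp n d) :=
  WithLp.toLp 2 fun α => √(Nat.multinomial Finset.univ α.1 : ℝ) * ∏ k, x k ^ α.1 k

theorem eval_weylPoly (c : EuclideanSpace ℝ (WExp n d)) (x : EuclideanSpace ℝ (Fin n)) :
    MvPolynomial.eval (fun k => x k) (weylPoly c) = inner ℝ c (weylVec d x) := by
  simp only [weylPoly, map_sum, MvPolynomial.eval_monomial, PiLp.inner_apply, weylVec]
  refine Finset.sum_congr rfl fun α _ => ?_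
  rw [Finsupp.prod_fintype _ _ (fun i => pow_zero _), RCLike.inner_apply, conj_trivial]
  ring

theorem WExp.sum_apply_eq (α : WExp n d) : ∑ k, α.1 k = d :=
  (Finset.mem_finsuppAntidiag.1 α.2).1

theorem sum_wExp {M : Type*} [AddCommMonoid M] (f : (Fin n → ℕ) → M) :
    ∑ α : WExp n d, f α.1 = ∑ k ∈ Finset.univ.piAntidiag d, f k := by
  refine Finset.sum_bij (fun α _ => (α.1 : Fin n → ℕ)) ?_ ?_ ?_ fun _ _ => rfl
  · exact fun α _ => by simp [α.sum_apply_eq]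
  · exact fun a _ b _ h => Subtype.ext (DFunLike.coe_injective h)
  · intro k hk
    have hsum : ∑ i, k i = d := (Finset.mem_piAntidiag.1 hk).1
    exact ⟨⟨Finsupp.equivFunOnFinite.symm k, by simp [Finset.mem_finsuppAntidiag, hsum]⟩,
      Finset.mem_univ _, by simp⟩

theorem card_wExp (n d : ℕ) : Fintype.card (WExp n d) = (n + d - 1).choose d := by
  rw [Fintype.card_coe, Finset.card_finsuppAntidiag_nat_eq_choose, Finset.card_univ,
    Fintype.card_fin]

theorem inner_weylVec (d : ℕ) (x y : EuclideanSpace ℝ (Fin n)) :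
    inner ℝ (weylVec d x) (weylVec d y) = inner ℝ x y ^ d := by
  have hterm (α : WExp n d) : inner ℝ (weylVec d x α) (weylVec d y α)
      = (Nat.multinomial Finset.univ α.1 : ℝ) * ∏ k, inner ℝ (x k) (y k) ^ α.1 k := by
    have hsq := Real.mul_self_sqrt (Nat.cast_nonneg (α := ℝ) (Nat.multinomial Finset.univ α.1))
    simp only [weylVec, RCLike.inner_apply, conj_trivial, mul_pow, Finset.prod_mul_distrib]
    linear_combination (∏ k, y k ^ α.1 k) * (∏ k, x k ^ α.1 k) * hsq
  simp only [PiLp.inner_apply, hterm]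
  rw [sum_wExp fun a => (Nat.multinomial Finset.univ a : ℝ) * ∏ k, inner ℝ (x k) (y k) ^ a k,
    ← Finset.sum_pow_eq_sum_piAntidiag]

theorem norm_weylVec (d : ℕ) (x : EuclideanSpace ℝ (Fin n)) : ‖weylVec d x‖ = ‖x‖ ^ d := by
  rw [← pow_left_inj₀ (norm_nonneg _) (by positivity) two_ne_zero, ← real_inner_self_eq_norm_sq,
    inner_weylVec, real_inner_self_eq_norm_sq, pow_right_comm]

theorem continuous_weylVec (d : ℕ) :
    Continuous (weylVec d : EuclideanSpace ℝ (Fin n) → EuclideanSpace ℝ (WExp n d)) := by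
  unfold weylVec
  fun_prop

theorem coeff_weylPoly (c : EuclideanSpace ℝ (WExp n d)) (α : WExp n d) :
    (weylPoly c).coeff α.1 = c α * √(Nat.multinomial Finset.univ α.1 : ℝ) := by
  classical
  rw [weylPoly, MvPolynomial.coeff_sum, Finset.sum_eq_single α]
  · simp
  · intro b _ hb
    rw [MvPolynomial.coeff_monomial, if_neg (fun h => hb (Subtype.ext h))]
  · simp

theorem weylNorm_weylPoly (c : EuclideanSpace ℝ (WExp n d)) : weylNorm d (weylPoly c) = ‖c‖ := by
  rw [weylNorm, EuclideanSpace.norm_eq]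
  congr 1
  refine Finset.sum_congr rfl fun α _ => ?_
  have h : (0 : ℝ) < (Nat.multinomial Finset.univ α.1 : ℝ) := by
    exact_mod_cast Nat.multinomial_pos _ _
  rw [coeff_weylPoly, sq_abs, mul_pow, Real.sq_sqrt h.le, Real.norm_eq_abs, sq_abs,
    mul_div_cancel_right₀ _ h.ne']

theorem weylNormSys_weylPoly (deg : Fin m → ℕ) (c : ∀ j, EuclideanSpace ℝ (WExp n (deg j))) :
    weylNormSys deg (fun j => weylPoly (c j)) = √(∑ j, ‖c j‖ ^ 2) := by
  simp only [weylNormSys, weylNorm_weylPoly]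

theorem totalDegree_weylPoly_le (c : EuclideanSpace ℝ (WExp n d)) :
    (weylPoly c).totalDegree ≤ d := by
  refine MvPolynomial.totalDegree_finsetSum_le fun α _ => ?_
  refine (MvPolynomial.totalDegree_monomial_le _ _).trans ?_
  rw [Finsupp.sum_fintype _ _ (fun _ => rfl)]
  exact α.sum_apply_eq.le

theorem evalSys_weylPoly_apply {deg : Fin m → ℕ} (c : ∀ j, EuclideanSpace ℝ (WExp n (deg j)))
    (x : EuclideanSpace ℝ (Fin n)) (j : Fin m) :
    evalSys (fun j => weylPoly (c j)) x j = inner ℝ (c j) (weylVec (deg j) x) :=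
  eval_weylPoly (c j) x

theorem norm_evalSys_weylPoly_sq {deg : Fin m → ℕ} (c : ∀ j, EuclideanSpace ℝ (WExp n (deg j)))
    (x : EuclideanSpace ℝ (Fin n)) :
    ‖evalSys (fun j => weylPoly (c j)) x‖ ^ 2
      = ∑ j, inner ℝ (c j) (weylVec (deg j) x) ^ 2 := by
  simp only [EuclideanSpace.norm_sq_eq, evalSys_weylPoly_apply, Real.norm_eq_abs, sq_abs]

end Weyl

section ConditionNumber

theorem exists_norm_eq_sigmaMin {E F : Type*} [NormedAddCommGroup E] [InnerProductSpace ℝ E]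
    [FiniteDimensional ℝ E] [NormedAddCommGroup F] [InnerProductSpace ℝ F] [FiniteDimensional ℝ F]
    [Nontrivial E] (T : E →ₗ[ℝ] F) : ∃ y : E, ‖y‖ = 1 ∧ ‖T y‖ = sigmaMin T := by
  have hE : 0 < Module.finrank ℝ E := Module.finrank_pos
  obtain ⟨v, hv⟩ := (T.hasEigenvalue_adjoint_comp_self_sq_singularValues
    (n := Module.finrank ℝ E - 1) (by omega)).exists_hasEigenvector
  have hv0 : ‖v‖ ≠ 0 := norm_ne_zero_iff.2 hv.2
  have hsq : ‖T v‖ ^ 2 = (sigmaMin T * ‖v‖) ^ 2 :=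
    calc ‖T v‖ ^ 2 = inner ℝ v ((LinearMap.adjoint T ∘ₗ T) v) := by
          rw [LinearMap.comp_apply, LinearMap.adjoint_inner_right, real_inner_self_eq_norm_sq]
      _ = (sigmaMin T * ‖v‖) ^ 2 := by
          rw [hv.apply_eq_smul, inner_smul_right, real_inner_self_eq_norm_sq, mul_pow]
          rfl
  have hTv : ‖T v‖ = sigmaMin T * ‖v‖ :=
    (pow_left_inj₀ (norm_nonneg _) (mul_nonneg (T.singularValues_nonneg _) (norm_nonneg v))
      two_ne_zero).1 hsq
  refine ⟨‖v‖⁻¹ • v, ?_, ?_⟩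
  · rw [norm_smul, norm_inv, norm_norm, inv_mul_cancel₀ hv0]
  · rw [map_smul, norm_smul, norm_inv, norm_norm, hTv]
    field_simp

variable {n m : ℕ} {deg : Fin m → ℕ} {P : Fin m → MvPolynomial (Fin n) ℝ}

/-- The derivative `DP(x) y` of a polynomial system at `x` in the direction `y`. -/
noncomputable def dirDeriv (P : Fin m → MvPolynomial (Fin n) ℝ) (x y : EuclideanSpace ℝ (Fin n)) :
    EuclideanSpace ℝ (Fin m) :=
  Matrix.toEuclideanLin (jacobianSys P x) y

theorem dirDeriv_apply_eq_sqrt_mul (hdeg : ∀ j, 1 ≤ deg j) (P : Fin m → MvPolynomial (Fin n) ℝ)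
    (x : EuclideanSpace ℝ (Fin n)) (y : sphereTangent x) (i : Fin m) :
    dirDeriv P x y i = √(deg i) * scaledTangentMap deg P x y i := by
  have hpos (i : Fin m) : (0 : ℝ) < √(deg i) := Real.sqrt_pos.2 (by exact_mod_cast hdeg i)
  have hinv : (Matrix.diagonal fun i => √(deg i : ℝ))⁻¹
      = Matrix.diagonal fun i => (√(deg i : ℝ))⁻¹ :=
    Matrix.inv_eq_left_inv (by simp [Matrix.diagonal_mul_diagonal, (hpos _).ne'])
  simp only [dirDeriv, scaledTangentMap, LinearMap.domRestrict_apply, hinv,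
    Matrix.toLpLin_apply, ← Matrix.mulVec_mulVec, Matrix.mulVec_diagonal]
  rw [mul_inv_cancel_left₀ (hpos i).ne']

theorem norm_dirDeriv_le (hdeg : ∀ j, 1 ≤ deg j) {d : ℕ} (hd : ∀ j, deg j ≤ d)
    (P : Fin m → MvPolynomial (Fin n) ℝ) (x : EuclideanSpace ℝ (Fin n)) (y : sphereTangent x) :
    ‖dirDeriv P x y‖ ≤ √d * ‖scaledTangentMap deg P x y‖ := by
  rw [EuclideanSpace.norm_eq, EuclideanSpace.norm_eq, ← Real.sqrt_mul (Nat.cast_nonneg _),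
    Finset.mul_sum]
  refine Real.sqrt_le_sqrt (Finset.sum_le_sum fun i _ => ?_)
  have hi : (deg i : ℝ) ≤ d := by exact_mod_cast hd i
  rw [dirDeriv_apply_eq_sqrt_mul hdeg, norm_mul, mul_pow, Real.norm_of_nonneg (Real.sqrt_nonneg _),
    Real.sq_sqrt (Nat.cast_nonneg _)]
  gcongr

theorem finrank_sphereTangent {x : EuclideanSpace ℝ (Fin n)} (hx : x ≠ 0) :
    Module.finrank ℝ (sphereTangent x) + 1 = n := by
  have h := Submodule.finrank_add_finrank_orthogonal (Submodule.span ℝ {x})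
  rwa [finrank_span_singleton hx, finrank_euclideanSpace_fin, add_comm] at h

theorem sigmaMin_scaledTangentMap_le_condL (deg : Fin m → ℕ) (P : Fin m → MvPolynomial (Fin n) ℝ)
    (x : EuclideanSpace ℝ (Fin n)) : sigmaMin (scaledTangentMap deg P x) ≤ condL deg P x :=
  Real.le_sqrt_of_sq_le (le_add_of_nonneg_right (sq_nonneg _))

theorem norm_evalSys_le_condL (deg : Fin m → ℕ) (P : Fin m → MvPolynomial (Fin n) ℝ)
    (x : EuclideanSpace ℝ (Fin n)) : ‖evalSys P x‖ ≤ condL deg P x :=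
  Real.le_sqrt_of_sq_le (le_add_of_nonneg_left (sq_nonneg _))

theorem exists_norm_dirDeriv_le_condL (hn : 2 ≤ n) (hdeg : ∀ j, 1 ≤ deg j) {d : ℕ}
    (hd : ∀ j, deg j ≤ d) (P : Fin m → MvPolynomial (Fin n) ℝ) {x : EuclideanSpace ℝ (Fin n)}
    (hx : x ≠ 0) :
    ∃ y, ‖y‖ = 1 ∧ inner ℝ x y = 0 ∧ ‖dirDeriv P x y‖ ≤ √d * condL deg P x := by
  have : Nontrivial (sphereTangent x) :=
    Module.nontrivial_of_finrank_pos (R := ℝ) (by have := finrank_sphereTangent hx; omega)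
  obtain ⟨y, hy, hTy⟩ := exists_norm_eq_sigmaMin (scaledTangentMap deg P x)
  refine ⟨y, hy, Submodule.mem_orthogonal_singleton_iff_inner_right.1 y.2, ?_⟩
  calc ‖dirDeriv P x y‖ ≤ √d * ‖scaledTangentMap deg P x y‖ := norm_dirDeriv_le hdeg hd P x y
    _ ≤ √d * condL deg P x := by
        rw [hTy]
        gcongr
        exact sigmaMin_scaledTangentMap_le_condL deg P x

theorem exists_condL_mul_le_of_lt_condGlobal {s : ℝ} (hs : 0 ≤ s)
    (h : ENNReal.ofReal s < condGlobal deg P) :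
    ∃ x, ‖x‖ = 1 ∧ condL deg P x * s ≤ weylNormSys deg P := by
  simp only [condGlobal, lt_iSup_iff] at h
  obtain ⟨x, hx, hlt⟩ := h
  refine ⟨x, by simpa using hx, ?_⟩
  have hL : 0 ≤ condL deg P x := Real.sqrt_nonneg _
  rcases hL.eq_or_lt with h0 | h0
  · rw [← h0, zero_mul]
    exact Real.sqrt_nonneg _
  · rw [condLocal, if_neg h0.ne', ENNReal.ofReal_lt_ofReal_iff_of_nonneg hs, lt_div_iff₀ h0,
      mul_comm] at hlt
    exact hlt.le

theorem exists_norm_evalSys_norm_dirDeriv_le_of_le_condGlobal (hn : 2 ≤ n)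
    (hdeg : ∀ j, 1 ≤ deg j) {d : ℕ} (hd : ∀ j, deg j ≤ d) {s a : ℝ} (hs : 0 < s)
    (ha : 2 * weylNormSys deg P ≤ a * s) (h : ENNReal.ofReal s ≤ condGlobal deg P) :
    ∃ x y : EuclideanSpace ℝ (Fin n), ‖x‖ = 1 ∧ ‖y‖ = 1 ∧ inner ℝ x y = 0 ∧
      ‖evalSys P x‖ ≤ a ∧ ‖dirDeriv P x y‖ ≤ √d * a := by
  have hlt : ENNReal.ofReal (s / 2) < condGlobal deg P :=
    ((ENNReal.ofReal_lt_ofReal_iff hs).2 (half_lt_self hs)).trans_le h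
  obtain ⟨x, hx, hxs⟩ := exists_condL_mul_le_of_lt_condGlobal (half_pos hs).le hlt
  have hL : condL deg P x ≤ a := le_of_mul_le_mul_right (by linarith) hs
  obtain ⟨y, hy, hxy, hDy⟩ := exists_norm_dirDeriv_le_condL hn hdeg hd P
    (norm_ne_zero_iff.1 (hx ▸ one_ne_zero))
  exact ⟨x, y, hx, hy, hxy, (norm_evalSys_le_condL deg P x).trans hL, hDy.trans (by gcongr)⟩

end ConditionNumber

section TrigonometricPolynomials

/-- `g` is a real trigonometric polynomial of degree at most `d`. Multiplying by `e^{idθ}` shifts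
the frequencies `-d, …, d` to `0, …, 2d`, so that an ordinary polynomial in `e^{iθ}` encodes `g`. -/
def IsTrigPoly (d : ℕ) (g : ℝ → ℝ) : Prop :=
  ∃ Q : Polynomial ℂ, Q.natDegree ≤ 2 * d ∧
    ∀ θ : ℝ, (g θ : ℂ) * Complex.exp (θ * Complex.I) ^ d = Q.eval (Complex.exp (θ * Complex.I))

theorem norm_coeff_le_of_forall_norm_eval_le (Q : Polynomial ℂ) {γ : ℝ}
    (h : ∀ z : ℂ, ‖z‖ = 1 → ‖Q.eval z‖ ≤ γ) (k : ℕ) : ‖Q.coeff k‖ ≤ γ := by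
  have hγ : 0 ≤ γ := (norm_nonneg _).trans (h 1 norm_one)
  have hint : CircleIntegrable (fun z => ‖Q.eval z‖ ^ 2) 0 1 :=
    ContinuousOn.circleIntegrable' (by fun_prop)
  have hparseval : ∑ i ∈ Q.support, ‖Q.coeff i‖ ^ 2 ≤ γ ^ 2 := by
    rw [Q.sum_sq_norm_coeff_eq_circleAverage]
    refine Real.circleAverage_mono_on_of_le_circle hint fun z hz => ?_
    have hz1 : ‖z‖ = 1 := by simpa using hz
    gcongr
    exact h z hz1
  by_cases hk : k ∈ Q.support
  · exact abs_le_of_sq_le_sq' ((Finset.single_le_sum (f := fun i => ‖Q.coeff i‖ ^ 2)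
      (fun _ _ => sq_nonneg _) hk).trans hparseval) hγ |>.2
  · rw [Polynomial.notMem_support_iff.1 hk, norm_zero]
    exact hγ

namespace IsTrigPoly

variable {d e : ℕ} {f g : ℝ → ℝ} {γ : ℝ}

theorem const (a : ℝ) : IsTrigPoly 0 fun _ => a :=
  ⟨Polynomial.C (a : ℂ), by simp, by simp⟩

theorem add (hf : IsTrigPoly d f) (hg : IsTrigPoly d g) : IsTrigPoly d fun θ => f θ + g θ := by
  obtain ⟨Q, hQ, hQe⟩ := hf
  obtain ⟨R, hR, hRe⟩ := hg
  refine ⟨Q + R, (Polynomial.natDegree_add_le _ _).trans (max_le hQ hR), fun θ => ?_⟩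
  rw [Polynomial.eval_add, ← hQe, ← hRe]
  push_cast
  ring

theorem mul (hf : IsTrigPoly d f) (hg : IsTrigPoly e g) :
    IsTrigPoly (d + e) fun θ => f θ * g θ := by
  obtain ⟨Q, hQ, hQe⟩ := hf
  obtain ⟨R, hR, hRe⟩ := hg
  refine ⟨Q * R, Polynomial.natDegree_mul_le.trans (by omega), fun θ => ?_⟩
  rw [Polynomial.eval_mul, ← hQe, ← hRe]
  push_cast
  ring

theorem mono (hf : IsTrigPoly d f) (hde : d ≤ e) : IsTrigPoly e f := by
  obtain ⟨Q, hQ, hQe⟩ := hf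
  refine ⟨Q * Polynomial.X ^ (e - d), Polynomial.natDegree_mul_le.trans ?_, fun θ => ?_⟩
  · have := Polynomial.natDegree_X_pow_le (R := ℂ) (e - d)
    omega
  · rw [Polynomial.eval_mul, ← hQe, Polynomial.eval_pow, Polynomial.eval_X, mul_assoc, ← pow_add,
      Nat.add_sub_cancel' hde]

theorem const_mul (a : ℝ) (hf : IsTrigPoly d f) : IsTrigPoly d fun θ => a * f θ := by
  simpa using (const a).mul hf

theorem sum {ι : Type*} (s : Finset ι) {f : ι → ℝ → ℝ} (hf : ∀ i ∈ s, IsTrigPoly d (f i)) :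
    IsTrigPoly d fun θ => ∑ i ∈ s, f i θ := by
  classical
  induction s using Finset.induction_on with
  | empty => simpa using (const 0).mono (Nat.zero_le d)
  | insert i s hi ih =>
    simp only [Finset.sum_insert hi]
    exact (hf i (Finset.mem_insert_self _ _)).add
      (ih fun j hj => hf j (Finset.mem_insert_of_mem hj))

theorem pow (hf : IsTrigPoly d f) (k : ℕ) : IsTrigPoly (k * d) fun θ => f θ ^ k := by
  induction k with
  | zero => simpa using const 1
  | succ k ih => simpa only [pow_succ, Nat.succ_mul] using ih.mul hf

theorem prod {ι : Type*} (s : Finset ι) {a : ι → ℕ} {f : ι → ℝ → ℝ}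
    (hf : ∀ i ∈ s, IsTrigPoly (a i) (f i)) :
    IsTrigPoly (∑ i ∈ s, a i) fun θ => ∏ i ∈ s, f i θ := by
  classical
  induction s using Finset.induction_on with
  | empty => simpa using const 1
  | insert i s hi ih =>
    simp only [Finset.sum_insert hi, Finset.prod_insert hi]
    exact (hf i (Finset.mem_insert_self _ _)).mul
      (ih fun j hj => hf j (Finset.mem_insert_of_mem hj))

theorem cos_mul_add_sin_mul (a b : ℝ) : IsTrigPoly 1 fun θ => Real.cos θ * a + Real.sin θ * b := by
  refine ⟨Polynomial.C (a / 2 : ℂ) * (Polynomial.X ^ 2 + 1)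
    - Polynomial.C (b / 2 * Complex.I : ℂ) * (Polynomial.X ^ 2 - 1), by compute_degree,
    fun θ => ?_⟩
  have hexp : Complex.exp (θ * Complex.I) = Complex.cos θ + Complex.sin θ * Complex.I :=
    Complex.exp_mul_I _
  have hpyth := Complex.sin_sq_add_cos_sq (θ : ℂ)
  simp only [Polynomial.eval_sub, Polynomial.eval_mul, Polynomial.eval_C, Polynomial.eval_add,
    Polynomial.eval_pow, Polynomial.eval_X, Polynomial.eval_one, hexp]
  push_cast
  linear_combination (a / 2 + b / 2 * Complex.I : ℂ) * hpyth +
    (-a / 2 * Complex.sin θ ^ 2 + b * Complex.sin θ * Complex.cos θ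
      + b / 2 * Complex.I * Complex.sin θ ^ 2) * Complex.I_sq

theorem mvPolynomial_eval {σ : Type*} {p : MvPolynomial σ ℝ} (hp : p.totalDegree ≤ d)
    {f : σ → ℝ → ℝ} (hf : ∀ i, IsTrigPoly 1 (f i)) :
    IsTrigPoly d fun θ => MvPolynomial.eval (fun i => f i θ) p := by
  simp only [MvPolynomial.eval_eq]
  refine sum _ fun s hs => const_mul _ ((prod s.support fun i _ => (hf i).pow (s i)).mono ?_)
  simp only [mul_one]
  exact (MvPolynomial.le_totalDegree hs).trans hp

theorem exists_coeff (hg : IsTrigPoly d g) (hγ : ∀ θ, |g θ| ≤ γ) :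
    ∃ c : ℕ → ℂ, (∀ k, ‖c k‖ ≤ γ) ∧ ∀ θ : ℝ,
      (g θ : ℂ) = ∑ k ∈ Finset.range (2 * d + 1),
        c k * Complex.exp (Complex.I * (((k : ℝ) - d) * θ : ℝ)) := by
  obtain ⟨Q, hQ, hQe⟩ := hg
  refine ⟨Q.coeff, norm_coeff_le_of_forall_norm_eval_le Q fun z hz => ?_, fun θ => ?_⟩
  · obtain ⟨θ, rfl⟩ := (Complex.norm_eq_one_iff z).1 hz
    rw [← hQe, norm_mul, norm_pow, Complex.norm_exp_ofReal_mul_I, one_pow, mul_one]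
    simpa using hγ θ
  · apply mul_right_cancel₀ (pow_ne_zero d (Complex.exp_ne_zero (θ * Complex.I)))
    rw [hQe, Polynomial.eval_eq_sum_range' (Nat.lt_succ_of_le hQ), Finset.sum_mul]
    refine Finset.sum_congr rfl fun k _ => ?_
    rw [mul_assoc, ← Complex.exp_nat_mul, ← Complex.exp_nat_mul, ← Complex.exp_add]
    congr 2
    push_cast
    ring

theorem norm_sum_coeff_mul_le (hd : 1 ≤ d) {c : ℕ → ℂ} (hc : ∀ k, ‖c k‖ ≤ γ) {h : ℝ → ℂ}
    {θ B : ℝ} (hh : ∀ s : ℝ, |s| ≤ d * |θ| → ‖h s‖ ≤ B) :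
    ‖∑ k ∈ Finset.range (2 * d + 1), c k * h (((k : ℝ) - d) * θ)‖ ≤ 3 * d * (γ * B) := by
  have hd' : (1 : ℝ) ≤ d := by exact_mod_cast hd
  have hγ : 0 ≤ γ := (norm_nonneg _).trans (hc 0)
  have hB : 0 ≤ B := (norm_nonneg _).trans (hh 0 (by simpa using by positivity))
  have hterm : ∀ k ∈ Finset.range (2 * d + 1), ‖c k * h (((k : ℝ) - d) * θ)‖ ≤ γ * B := by
    intro k hk
    have hk2 : (k : ℝ) ≤ 2 * d := by exact_mod_cast Nat.lt_succ_iff.1 (Finset.mem_range.1 hk)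
    have hkd : |(k : ℝ) - d| ≤ d :=
      abs_le.2 ⟨by linarith [(Nat.cast_nonneg k : (0 : ℝ) ≤ k)], by linarith⟩
    rw [norm_mul]
    exact mul_le_mul (hc k) (hh _ (by rw [abs_mul]; gcongr)) (norm_nonneg _) hγ
  calc _ ≤ ∑ _k ∈ Finset.range (2 * d + 1), γ * B := norm_sum_le_of_le _ hterm
    _ = (2 * d + 1) * (γ * B) := by simp
    _ ≤ 3 * d * (γ * B) := by gcongr; linarith

theorem abs_sub_le (hg : IsTrigPoly d g) (hd : 1 ≤ d) (hγ : ∀ θ, |g θ| ≤ γ) (θ : ℝ) :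
    |g θ - g 0| ≤ 3 * d ^ 2 * γ * |θ| := by
  obtain ⟨c, hc, hce⟩ := hg.exists_coeff hγ
  have hsum : ((g θ - g 0 : ℝ) : ℂ) = ∑ k ∈ Finset.range (2 * d + 1),
      c k * (Complex.exp (Complex.I * (((k : ℝ) - d) * θ : ℝ)) - 1) := by
    push_cast [hce]
    rw [← Finset.sum_sub_distrib]
    exact Finset.sum_congr rfl fun k _ => by simp [mul_sub]
  rw [← Real.norm_eq_abs, ← Complex.norm_real, hsum]
  refine (norm_sum_coeff_mul_le (h := fun s => Complex.exp (Complex.I * (s : ℝ)) - 1) hd hc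
    fun s hs => Real.norm_exp_I_mul_ofReal_sub_one_le.trans hs).trans_eq ?_
  ring

theorem hasDerivAt_coeff_eq {D : ℝ} {c : ℕ → ℂ} (hc : ∀ θ : ℝ,
      (g θ : ℂ) = ∑ k ∈ Finset.range (2 * d + 1),
        c k * Complex.exp (Complex.I * (((k : ℝ) - d) * θ : ℝ))) (hD : HasDerivAt g D 0) :
    (D : ℂ) = ∑ k ∈ Finset.range (2 * d + 1), c k * (Complex.I * ((k : ℝ) - d : ℝ)) := by
  refine hD.ofReal_comp.unique ?_
  simp only [hc]
  refine HasDerivAt.fun_sum fun k _ => HasDerivAt.const_mul _ ?_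
  have hlin : HasDerivAt (fun θ : ℝ => Complex.I * (((k : ℝ) - d) * θ : ℝ))
      (Complex.I * ((k : ℝ) - d : ℝ)) 0 := by
    simpa using (((hasDerivAt_id (0 : ℝ)).const_mul ((k : ℝ) - d)).ofReal_comp).const_mul Complex.I
  simpa using hlin.cexp

theorem abs_sub_sub_mul_le (hg : IsTrigPoly d g) (hd : 1 ≤ d) {D : ℝ} (hγ : ∀ θ, |g θ| ≤ γ)
    (hD : HasDerivAt g D 0) {θ : ℝ} (hθ : d * |θ| ≤ 1) :
    |g θ - g 0 - θ * D| ≤ 3 * d ^ 3 * γ * θ ^ 2 := by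
  obtain ⟨c, hc, hce⟩ := hg.exists_coeff hγ
  have hsum : ((g θ - g 0 - θ * D : ℝ) : ℂ) = ∑ k ∈ Finset.range (2 * d + 1),
      c k * (Complex.exp (Complex.I * (((k : ℝ) - d) * θ : ℝ)) - 1
        - Complex.I * (((k : ℝ) - d) * θ : ℝ)) := by
    push_cast [hce, hasDerivAt_coeff_eq hce hD]
    rw [← Finset.sum_sub_distrib, Finset.mul_sum, ← Finset.sum_sub_distrib]
    refine Finset.sum_congr rfl fun k _ => ?_
    simp only [mul_zero, Complex.exp_zero]
    ring
  rw [← Real.norm_eq_abs, ← Complex.norm_real, hsum]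
  refine (norm_sum_coeff_mul_le (B := (d * |θ|) ^ 2)
    (h := fun s => Complex.exp (Complex.I * (s : ℝ)) - 1 - Complex.I * (s : ℝ)) hd hc
    fun s hs => ?_).trans_eq ?_
  · have hs' : ‖Complex.I * (s : ℂ)‖ ≤ d * |θ| := by simpa using hs
    exact (Complex.norm_exp_sub_one_sub_id_le (hs'.trans hθ)).trans (by gcongr)
  · rw [mul_pow, sq_abs]
    ring

end IsTrigPoly

end TrigonometricPolynomials

section Circle

theorem hasDerivAt_mvPolynomial_eval {σ : Type*} [Fintype σ] (p : MvPolynomial σ ℝ)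
    {f : σ → ℝ → ℝ} {f' : σ → ℝ} {t : ℝ} (hf : ∀ k, HasDerivAt (f k) (f' k) t) :
    HasDerivAt (fun θ => MvPolynomial.eval (fun k => f k θ) p)
      (∑ k, MvPolynomial.eval (fun l => f l t) (MvPolynomial.pderiv k p) * f' k) t := by
  classical
  induction p using MvPolynomial.induction_on with
  | C a => simpa using hasDerivAt_const t a
  | add p q hp hq =>
    simp only [map_add, add_mul, Finset.sum_add_distrib]
    exact hp.add hq
  | mul_X p i hp =>
    simp only [map_mul, MvPolynomial.eval_X]
    convert! hp.mul (hf i) using 1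
    have hterm (k : σ) :
        MvPolynomial.eval (fun l => f l t) (MvPolynomial.pderiv k (p * MvPolynomial.X i)) * f' k
          = MvPolynomial.eval (fun l => f l t) (MvPolynomial.pderiv k p) * f' k * f i t
            + if i = k then MvPolynomial.eval (fun l => f l t) p * f' k else 0 := by
      rcases eq_or_ne i k with rfl | hik
      · simp [Derivation.leibniz]
        ring
      · simp [Derivation.leibniz, MvPolynomial.pderiv_X_of_ne hik, hik]
        ring
    simp only [hterm, Finset.sum_add_distrib, Finset.sum_mul, Finset.sum_ite_eq, Finset.mem_univ,
      if_true]

variable {E : Type*} [NormedAddCommGroup E] [InnerProductSpace ℝ E]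

theorem norm_cos_smul_add_sin_smul {x y : E} (hx : ‖x‖ = 1) (hy : ‖y‖ = 1)
    (hxy : inner ℝ x y = 0) (θ : ℝ) : ‖Real.cos θ • x + Real.sin θ • y‖ = 1 := by
  rw [← pow_left_inj₀ (norm_nonneg _) zero_le_one two_ne_zero, norm_add_sq_real, norm_smul,
    norm_smul, inner_smul_left, inner_smul_right, hxy, hx, hy]
  simp

theorem exists_eq_cos_smul_add_sin_smul {x z : E} (hx : ‖x‖ = 1) (hz : ‖z‖ = 1) (hzx : z ≠ x)
    (hzx' : z ≠ -x) :
    ∃ (y : E) (θ : ℝ), ‖y‖ = 1 ∧ inner ℝ x y = 0 ∧ |θ| ≤ Real.pi / 2 * ‖z - x‖ ∧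
      z = Real.cos θ • x + Real.sin θ • y := by
  set θ := InnerProductGeometry.angle x z
  have hcos : Real.cos θ = inner ℝ x z := by
    simp [θ, InnerProductGeometry.cos_angle, hx, hz]
  set v := z - Real.cos θ • x with hv
  have hxv : inner ℝ x v = 0 := by
    rw [hv, inner_sub_right, inner_smul_right, real_inner_self_eq_norm_sq, hx, ← hcos]
    ring
  have hvnorm : ‖v‖ = Real.sin θ := by
    rw [← pow_left_inj₀ (norm_nonneg _) (InnerProductGeometry.sin_angle_nonneg x z) two_ne_zero,
      hv, norm_sub_sq_real, inner_smul_right, norm_smul, hx, hz, real_inner_comm, ← hcos,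
      Real.sin_sq, Real.norm_eq_abs, mul_pow, sq_abs]
    ring
  have hsin : Real.sin θ ≠ 0 := fun h => by
    have hzv : z = Real.cos θ • x := sub_eq_zero.1 (norm_eq_zero.1 (hvnorm.trans h))
    rcases Real.sin_eq_zero_iff_cos_eq.1 h with h1 | h1
    · exact hzx (by rw [hzv, h1, one_smul])
    · exact hzx' (by rw [hzv, h1, neg_one_smul])
  refine ⟨(Real.sin θ)⁻¹ • v, θ, ?_, by rw [inner_smul_right, hxv, mul_zero], ?_, ?_⟩
  · rw [norm_smul, hvnorm, norm_inv, Real.norm_of_nonneg (hvnorm ▸ norm_nonneg v),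
      inv_mul_cancel₀ hsin]
  · have hθ : |θ| ≤ Real.pi := abs_le.2
      ⟨by linarith [InnerProductGeometry.angle_nonneg x z, Real.pi_pos],
        InnerProductGeometry.angle_le_pi x z⟩
    have hchord : ‖z - x‖ ^ 2 = 2 - 2 * Real.cos θ := by
      rw [norm_sub_sq_real, hx, hz, real_inner_comm, hcos]
      ring
    refine abs_le_of_sq_le_sq (le_of_sub_nonneg ?_) (by positivity)
    have hquad := Real.cos_le_one_sub_mul_cos_sq hθ
    calc (0 : ℝ) ≤ Real.pi ^ 2 / 2 * (1 - 2 / Real.pi ^ 2 * θ ^ 2 - Real.cos θ) :=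
          mul_nonneg (by positivity) (by linarith)
      _ = (Real.pi / 2 * ‖z - x‖) ^ 2 - θ ^ 2 := by
          rw [mul_pow, hchord]
          field_simp
          ring
  · rw [smul_smul, mul_inv_cancel₀ hsin, one_smul, hv]
    abel

theorem norm_le_of_forall_abs_inner_le {v : E} {b : ℝ} (hb : 0 ≤ b)
    (h : ∀ u : E, ‖u‖ = 1 → |inner ℝ u v| ≤ b) : ‖v‖ ≤ b := by
  rcases eq_or_ne v 0 with rfl | hv
  · simpa using hb
  · have hv0 : ‖v‖ ≠ 0 := norm_ne_zero_iff.2 hv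
    have hinner : inner ℝ (NormedSpace.normalize v) v = ‖v‖ := by
      rw [NormedSpace.normalize, inner_smul_left, real_inner_self_eq_norm_sq, conj_trivial]
      field_simp
    simpa only [hinner, abs_norm] using h _ (NormedSpace.norm_normalize hv)

variable {n m : ℕ} {P : Fin m → MvPolynomial (Fin n) ℝ} {d : ℕ} {γ : ℝ}

theorem isTrigPoly_inner_evalSys (hP : ∀ j, (P j).totalDegree ≤ d)
    (x y : EuclideanSpace ℝ (Fin n)) (u : EuclideanSpace ℝ (Fin m)) :
    IsTrigPoly d fun θ => inner ℝ u (evalSys P (Real.cos θ • x + Real.sin θ • y)) := by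
  simp only [PiLp.inner_apply, evalSys, RCLike.inner_apply, conj_trivial, mul_comm _ (u.ofLp _)]
  exact IsTrigPoly.sum _ fun j _ => IsTrigPoly.const_mul _
    (IsTrigPoly.mvPolynomial_eval (hP j) fun k => IsTrigPoly.cos_mul_add_sin_mul (x k) (y k))

theorem hasDerivAt_inner_evalSys (x y : EuclideanSpace ℝ (Fin n)) (u : EuclideanSpace ℝ (Fin m)) :
    HasDerivAt (fun θ => inner ℝ u (evalSys P (Real.cos θ • x + Real.sin θ • y)))
      (inner ℝ u (dirDeriv P x y)) 0 := by
  simp only [PiLp.inner_apply, evalSys, RCLike.inner_apply, conj_trivial, mul_comm _ (u.ofLp _)]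
  refine HasDerivAt.fun_sum fun j _ => HasDerivAt.const_mul _ ?_
  have hcircle (k : Fin n) :
      HasDerivAt (fun θ => Real.cos θ * x k + Real.sin θ * y k) (y k) 0 := by
    simpa using ((Real.hasDerivAt_cos 0).mul_const (x k)).fun_add
      ((Real.hasDerivAt_sin 0).mul_const (y k))
  convert! hasDerivAt_mvPolynomial_eval (P j) hcircle using 1
  simp [dirDeriv, Matrix.toLpLin_apply, Matrix.mulVec, dotProduct, jacobianSys]

theorem abs_inner_evalSys_circle_le (hγ : ∀ x, ‖x‖ = 1 → ‖evalSys P x‖ ≤ γ)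
    {x y : EuclideanSpace ℝ (Fin n)} (hx : ‖x‖ = 1) (hy : ‖y‖ = 1) (hxy : inner ℝ x y = 0)
    {u : EuclideanSpace ℝ (Fin m)} (hu : ‖u‖ = 1) (θ : ℝ) :
    |inner ℝ u (evalSys P (Real.cos θ • x + Real.sin θ • y))| ≤ γ := by
  refine (abs_real_inner_le_norm _ _).trans ?_
  rw [hu, one_mul]
  exact hγ _ (norm_cos_smul_add_sin_smul hx hy hxy θ)

theorem norm_evalSys_circle_sub_le (hP : ∀ j, (P j).totalDegree ≤ d) (hd : 1 ≤ d)
    (hγ : ∀ x, ‖x‖ = 1 → ‖evalSys P x‖ ≤ γ) {x y : EuclideanSpace ℝ (Fin n)} (hx : ‖x‖ = 1)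
    (hy : ‖y‖ = 1) (hxy : inner ℝ x y = 0) (θ : ℝ) :
    ‖evalSys P (Real.cos θ • x + Real.sin θ • y) - evalSys P x‖ ≤ 3 * d ^ 2 * γ * |θ| := by
  have hγ0 : 0 ≤ γ := (norm_nonneg _).trans (hγ x hx)
  refine norm_le_of_forall_abs_inner_le (by positivity) fun u hu => ?_
  have h := (isTrigPoly_inner_evalSys hP x y u).abs_sub_le hd
    (abs_inner_evalSys_circle_le hγ hx hy hxy hu) θ
  simpa [inner_sub_right] using h

theorem norm_evalSys_circle_sub_sub_le (hP : ∀ j, (P j).totalDegree ≤ d) (hd : 1 ≤ d)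
    (hγ : ∀ x, ‖x‖ = 1 → ‖evalSys P x‖ ≤ γ) {x y : EuclideanSpace ℝ (Fin n)} (hx : ‖x‖ = 1)
    (hy : ‖y‖ = 1) (hxy : inner ℝ x y = 0) {θ : ℝ} (hθ : d * |θ| ≤ 1) :
    ‖evalSys P (Real.cos θ • x + Real.sin θ • y) - evalSys P x - θ • dirDeriv P x y‖
      ≤ 3 * d ^ 3 * γ * θ ^ 2 := by
  have hγ0 : 0 ≤ γ := (norm_nonneg _).trans (hγ x hx)
  refine norm_le_of_forall_abs_inner_le (by positivity) fun u hu => ?_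
  have h := (isTrigPoly_inner_evalSys hP x y u).abs_sub_sub_mul_le hd
    (abs_inner_evalSys_circle_le hγ hx hy hxy hu) (hasDerivAt_inner_evalSys x y u) hθ
  simpa [inner_sub_right, inner_smul_right] using h

theorem norm_evalSys_sub_le (hP : ∀ j, (P j).totalDegree ≤ d) (hd : 1 ≤ d)
    (hγ : ∀ x, ‖x‖ = 1 → ‖evalSys P x‖ ≤ γ) {x z : EuclideanSpace ℝ (Fin n)} (hx : ‖x‖ = 1)
    (hz : ‖z‖ = 1) : ‖evalSys P z - evalSys P x‖ ≤ 5 * d ^ 2 * γ * ‖z - x‖ := by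
  have hγ0 : 0 ≤ γ := (norm_nonneg _).trans (hγ x hx)
  rcases eq_or_ne z x with rfl | hzx
  · simp
  rcases eq_or_ne z (-x) with rfl | hzx'
  · have hd2 : (1 : ℝ) ≤ (d : ℝ) ^ 2 := one_le_pow₀ (by exact_mod_cast hd)
    have hnorm : ‖-x - x‖ = 2 := by
      rw [← neg_add', norm_neg, ← two_smul ℝ, norm_smul, hx]
      norm_num
    calc ‖evalSys P (-x) - evalSys P x‖ ≤ γ + γ := norm_sub_le_of_le (hγ _ hz) (hγ x hx)
      _ ≤ 5 * 1 * γ * 2 := by linarith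
      _ ≤ 5 * d ^ 2 * γ * ‖-x - x‖ := by rw [hnorm]; gcongr
  obtain ⟨y, θ, hy, hxy, hθ, hzθ⟩ := exists_eq_cos_smul_add_sin_smul hx hz hzx hzx'
  calc ‖evalSys P z - evalSys P x‖ ≤ 3 * d ^ 2 * γ * |θ| := by
        simpa only [← hzθ] using norm_evalSys_circle_sub_le hP hd hγ hx hy hxy θ
    _ ≤ 3 * d ^ 2 * γ * (5 / 3 * ‖z - x‖) := by
        gcongr
        exact hθ.trans (mul_le_mul_of_nonneg_right (by linarith [Real.pi_lt_d2]) (norm_nonneg _))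
    _ = 5 * d ^ 2 * γ * ‖z - x‖ := by ring

end Circle

section Geometry

variable {E : Type*} [NormedAddCommGroup E]

theorem norm_normalize_sub_normalize_le [NormedSpace ℝ E] {v w : E} (hv : 1 ≤ ‖v‖)
    (hw : 1 ≤ ‖w‖) :
    ‖NormedSpace.normalize v - NormedSpace.normalize w‖ ≤ 2 * ‖v - w‖ := by
  have hw1 : ‖NormedSpace.normalize w‖ = 1 :=
    NormedSpace.norm_normalize (norm_pos_iff.1 (one_pos.trans_le hw))
  have hsplit : NormedSpace.normalize v - NormedSpace.normalize w
      = ‖v‖⁻¹ • ((v - w) + (‖w‖ - ‖v‖) • NormedSpace.normalize w) := by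
    rw [smul_add, smul_smul, mul_sub, inv_mul_cancel₀ (by positivity), sub_smul, one_smul,
      mul_smul, NormedSpace.norm_smul_normalize, smul_sub]
    simp only [NormedSpace.normalize]
    abel
  calc ‖NormedSpace.normalize v - NormedSpace.normalize w‖
      = ‖v‖⁻¹ * ‖(v - w) + (‖w‖ - ‖v‖) • NormedSpace.normalize w‖ := by
        rw [hsplit, norm_smul, norm_inv, norm_norm]
    _ ≤ 1 * (‖v - w‖ + ‖v - w‖) := by
        refine mul_le_mul (inv_le_one_of_one_le₀ hv) (norm_add_le_of_le le_rfl ?_) (norm_nonneg _)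
          zero_le_one
        rw [norm_smul, hw1, mul_one, norm_sub_rev v w]
        exact abs_norm_sub_norm_le w v
    _ = 2 * ‖v - w‖ := by ring

section AxisScale

variable {ι : Type*} [Fintype ι] [InnerProductSpace ℝ E]

open Classical in
/-- The linear map that scales the `i`-th axis of the orthonormal basis `e` by the factor `a i`. -/
noncomputable def axisScale (e : OrthonormalBasis ι ℝ E) (a : ι → ℝ) : E →ₗ[ℝ] E :=
  Matrix.toLin e.toBasis e.toBasis (Matrix.diagonal a)

theorem det_axisScale (e : OrthonormalBasis ι ℝ E) (a : ι → ℝ) :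
    LinearMap.det (axisScale e a) = ∏ i, a i := by
  classical
  rw [axisScale, LinearMap.det_toLin, Matrix.det_diagonal]

theorem axisScale_apply (e : OrthonormalBasis ι ℝ E) (a : ι → ℝ) (v : E) :
    axisScale e a v = ∑ i, (a i * inner ℝ (e i) v) • e i := by
  simp [axisScale, Matrix.toLin_apply, Matrix.mulVec_diagonal, e.repr_apply_apply]

theorem norm_axisScale_le (e : OrthonormalBasis ι ℝ E) {a : ι → ℝ} {C : ℝ} (hC : 0 ≤ C)
    (ha : ∀ i, |a i| ≤ C) (v : E) : ‖axisScale e a v‖ ≤ C * ‖v‖ := by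
  refine abs_le_of_sq_le_sq' ?_ (by positivity) |>.2
  have hcoord (i : ι) : inner ℝ (e i) (axisScale e a v) = a i * inner ℝ (e i) v := by
    classical
    simp [axisScale_apply, inner_sum, inner_smul_right, orthonormal_iff_ite.1 e.orthonormal]
  rw [mul_pow, ← e.sum_sq_norm_inner_right, ← e.sum_sq_norm_inner_right v, Finset.mul_sum]
  refine Finset.sum_le_sum fun i _ => ?_
  rw [hcoord, norm_mul, mul_pow]
  gcongr
  exact ha i

theorem smul_add_axisScale_cons_cons_sub {k : ℕ} (e : OrthonormalBasis (Fin (k + 2)) ℝ E)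
    (c a δ ε : ℝ) (v : E) :
    c • e 0 + axisScale e (Fin.cons a (Fin.cons δ fun _ => ε)) v
        - ((c + a * inner ℝ (e 0) v) • e 0 + (δ * inner ℝ (e 1) v) • e 1)
      = axisScale e (Fin.cons 0 (Fin.cons 0 fun _ => ε)) v := by
  simp only [axisScale_apply, Fin.sum_univ_succ, Fin.cons_zero, Fin.cons_succ, Fin.succ_zero_eq_one,
    zero_mul, zero_smul, zero_add]
  module

end AxisScale

theorem exists_orthonormalBasis_apply_eq {k : ℕ} {x y : EuclideanSpace ℝ (Fin (k + 2))}
    (hx : ‖x‖ = 1) (hy : ‖y‖ = 1) (hxy : inner ℝ x y = 0) :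
    ∃ e : OrthonormalBasis (Fin (k + 2)) ℝ (EuclideanSpace ℝ (Fin (k + 2))), e 0 = x ∧ e 1 = y := by
  have hyx : inner ℝ y x = 0 := by rwa [real_inner_comm]
  have hortho : Orthonormal ℝ (({0, 1} : Set (Fin (k + 2))).domRestrict
      (fun i => if i = 0 then x else y)) := by
    rw [orthonormal_iff_ite]
    rintro ⟨i, hi⟩ ⟨j, hj⟩
    rcases hi with rfl | rfl <;> rcases hj with rfl | rfl <;>
      simp [hx, hy, hxy, hyx, Subtype.ext_iff]
  obtain ⟨e, he⟩ := hortho.exists_orthonormalBasis_extension_of_card_eq (by simp)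
  exact ⟨e, by simpa using he 0 (by simp), by simpa using he 1 (by simp)⟩

theorem abs_arctan_le_abs (t : ℝ) : |Real.arctan t| ≤ |t| := by
  wlog ht : 0 ≤ t generalizing t
  · simpa only [Real.arctan_neg, abs_neg] using this (-t) (by linarith)
  have harctan : 0 ≤ Real.arctan t := Real.arctan_nonneg.2 ht
  rw [abs_of_nonneg harctan, abs_of_nonneg ht]
  simpa only [Real.tan_arctan] using Real.le_tan harctan (Real.arctan_lt_pi_div_two t)

theorem exists_normalize_smul_add_smul_eq [InnerProductSpace ℝ E] {x y : E} (hx : ‖x‖ = 1)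
    (hy : ‖y‖ = 1) (hxy : inner ℝ x y = 0) {l t : ℝ} (hl : 1 ≤ l) :
    ∃ θ : ℝ, |θ| ≤ |t| ∧
      NormedSpace.normalize (l • x + t • y) = Real.cos θ • x + Real.sin θ • y := by
  have hl0 : 0 < l := one_pos.trans_le hl
  set θ := Real.arctan (t / l)
  have hcos : 0 < Real.cos θ := Real.cos_arctan_pos _
  have htan : t / l = Real.tan θ := (Real.tan_arctan _).symm
  refine ⟨θ, ?_, ?_⟩
  · calc |θ| ≤ |t / l| := abs_arctan_le_abs _
      _ = |t| / l := by rw [abs_div, abs_of_pos hl0]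
      _ ≤ |t| := div_le_self (abs_nonneg t) hl
  · have hsin : t = l / Real.cos θ * Real.sin θ := by
      rw [div_mul_eq_mul_div, mul_div_assoc, ← Real.tan_eq_sin_div_cos, ← htan]
      field_simp
    have hsmul : l • x + t • y = (l / Real.cos θ) • (Real.cos θ • x + Real.sin θ • y) := by
      rw [smul_add, smul_smul, smul_smul, ← hsin, div_mul_cancel₀ _ hcos.ne']
    rw [hsmul, NormedSpace.normalize_smul_of_pos (div_pos hl0 hcos),
      NormedSpace.normalize_eq_self_of_norm_eq_one (norm_cos_smul_add_sin_smul hx hy hxy θ)]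

/-- The set is an ellipsoid centred at `5 / 4 • x`, with semi-axes `1 / 4` along `x`, `δ` along `y`
and `ε` in the remaining directions. -/
theorem exists_volume_eq_forall_norm_sub_le {n : ℕ} (hn : 2 ≤ n) {x y : EuclideanSpace ℝ (Fin n)}
    (hx : ‖x‖ = 1) (hy : ‖y‖ = 1) (hxy : inner ℝ x y = 0) {δ ε : ℝ} (hδ0 : 0 ≤ δ)
    (hδ : δ ≤ 1 / 4) (hε0 : 0 ≤ ε) (hε : ε ≤ 1 / 4) :
    ∃ S : Set (EuclideanSpace ℝ (Fin n)),
      volume S = ENNReal.ofReal (1 / 4 * δ * ε ^ (n - 2)) *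
        volume (Metric.closedBall (0 : EuclideanSpace ℝ (Fin n)) 1) ∧
      ∀ w ∈ S, 1 ≤ ‖w‖ ∧ ‖w‖ ≤ 2 ∧
        ∃ l t : ℝ, 1 ≤ l ∧ |t| ≤ δ ∧ ‖w - (l • x + t • y)‖ ≤ ε := by
  obtain ⟨k, rfl⟩ : ∃ k, n = k + 2 := ⟨n - 2, by omega⟩
  obtain ⟨e, rfl, rfl⟩ := exists_orthonormalBasis_apply_eq hx hy hxy
  have hcenter : ‖(5 / 4 : ℝ) • e 0‖ = 5 / 4 := by rw [norm_smul, hx]; norm_num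
  let axes : Fin (k + 2) → ℝ := Fin.cons (1 / 4) (Fin.cons δ fun _ => ε)
  have haxes : ∀ i, |axes i| ≤ 1 / 4 := by
    simp only [axes, Fin.forall_fin_succ, Fin.cons_zero, Fin.cons_succ, abs_of_nonneg hδ0,
      abs_of_nonneg hε0, hδ, hε, implies_true, and_true]
    norm_num
  let cross : Fin (k + 2) → ℝ := Fin.cons 0 (Fin.cons 0 fun _ => ε)
  have hcross : ∀ i, |cross i| ≤ ε := by
    simp only [cross, Fin.forall_fin_succ, Fin.cons_zero, Fin.cons_succ, abs_zero,
      abs_of_nonneg hε0, hε0, le_refl, implies_true, and_true]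
  refine ⟨(fun v => (5 / 4 : ℝ) • e 0 + v) '' (axisScale e axes '' Metric.closedBall 0 1), ?_, ?_⟩
  · have hprod : ∏ i, axes i = 1 / 4 * δ * ε ^ k := by
      simp [axes, Fin.prod_univ_succ, mul_assoc]
    rw [Set.image_add_left, measure_preimage_add, Measure.addHaar_image_linearMap,
      det_axisScale, hprod, abs_of_nonneg (by positivity), Nat.add_sub_cancel]
  rintro _ ⟨_, ⟨v, hv, rfl⟩, rfl⟩
  rw [mem_closedBall_zero_iff] at hv
  have hscale : ‖axisScale e axes v‖ ≤ 1 / 4 :=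
    (norm_axisScale_le e (by norm_num) haxes v).trans (by linarith)
  have hcoord {u : EuclideanSpace ℝ (Fin (k + 2))} (hu : ‖u‖ = 1) : |inner ℝ u v| ≤ 1 :=
    (abs_real_inner_le_norm u v).trans (by rwa [hu, one_mul])
  refine ⟨?_, ?_, 5 / 4 + 1 / 4 * inner ℝ (e 0) v, δ * inner ℝ (e 1) v, ?_, ?_, ?_⟩
  · have := norm_sub_le_norm_add ((5 / 4 : ℝ) • e 0) (axisScale e axes v)
    linarith
  · have := norm_add_le ((5 / 4 : ℝ) • e 0) (axisScale e axes v)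
    linarith
  · linarith [(abs_le.1 (hcoord hx)).1]
  · rw [abs_mul, abs_of_nonneg hδ0]
    exact mul_le_of_le_one_right hδ0 (hcoord hy)
  · rw [smul_add_axisScale_cons_cons_sub]
    exact (norm_axisScale_le e hε0 hcross v).trans (mul_le_of_le_one_right hε0 hv)

end Geometry

section LargeSets

variable {n m : ℕ} {P : Fin m → MvPolynomial (Fin n) ℝ} {d : ℕ} {γ : ℝ}

theorem norm_evalSys_circle_le (hP : ∀ j, (P j).totalDegree ≤ d) (hd : 1 ≤ d)
    (hγ : ∀ x, ‖x‖ = 1 → ‖evalSys P x‖ ≤ γ) {x y : EuclideanSpace ℝ (Fin n)} (hx : ‖x‖ = 1)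
    (hy : ‖y‖ = 1) (hxy : inner ℝ x y = 0) {α δ : ℝ} (hα : 0 ≤ α) (hδ : d * δ ≤ 1 / 4)
    (hδγ : 3 * d ^ 3 * γ * δ ^ 2 ≤ α / 5) (hPx : ‖evalSys P x‖ ≤ α)
    (hPy : ‖dirDeriv P x y‖ ≤ √d * α) {θ : ℝ} (hθ : |θ| ≤ δ) :
    ‖evalSys P (Real.cos θ • x + Real.sin θ • y)‖ ≤ 3 / 2 * α := by
  have hγ0 : 0 ≤ γ := (norm_nonneg _).trans (hγ x hx)
  have hd' : (1 : ℝ) ≤ d := by exact_mod_cast hd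
  have hdθ : d * |θ| ≤ d * δ := by gcongr
  have hremainder : ‖evalSys P (Real.cos θ • x + Real.sin θ • y) - evalSys P x
      - θ • dirDeriv P x y‖ ≤ α / 5 :=
    calc _ ≤ 3 * d ^ 3 * γ * θ ^ 2 :=
          norm_evalSys_circle_sub_sub_le hP hd hγ hx hy hxy (by linarith)
      _ ≤ 3 * d ^ 3 * γ * δ ^ 2 := by
          rw [← sq_abs θ]
          gcongr
      _ ≤ α / 5 := hδγ
  have hlinear : ‖θ • dirDeriv P x y‖ ≤ α / 4 :=
    calc ‖θ • dirDeriv P x y‖ ≤ |θ| * (d * α) := by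
          rw [norm_smul, Real.norm_eq_abs]
          gcongr
          refine hPy.trans (mul_le_mul_of_nonneg_right ?_ hα)
          exact Real.sqrt_le_iff.2 ⟨by linarith, le_self_pow₀ hd' two_ne_zero⟩
      _ = d * |θ| * α := by ring
      _ ≤ 1 / 4 * α := by gcongr; linarith
      _ = α / 4 := by ring
  calc ‖evalSys P (Real.cos θ • x + Real.sin θ • y)‖
      = ‖(evalSys P (Real.cos θ • x + Real.sin θ • y) - evalSys P x - θ • dirDeriv P x y)
        + θ • dirDeriv P x y + evalSys P x‖ := by
        congr 1
        abel
    _ ≤ α / 5 + α / 4 + α := norm_add_le_of_le (norm_add_le_of_le hremainder hlinear) hPx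
    _ ≤ 3 / 2 * α := by linarith

theorem norm_evalSys_normalize_sub_le (hP : ∀ j, (P j).totalDegree ≤ d) (hd : 1 ≤ d)
    (hγ : ∀ x, ‖x‖ = 1 → ‖evalSys P x‖ ≤ γ) {v w : EuclideanSpace ℝ (Fin n)} (hv : 1 ≤ ‖v‖)
    (hw : 1 ≤ ‖w‖) :
    ‖evalSys P (NormedSpace.normalize w) - evalSys P (NormedSpace.normalize v)‖
      ≤ 10 * d ^ 2 * γ * ‖w - v‖ := by
  have hv1 : ‖NormedSpace.normalize v‖ = 1 :=
    NormedSpace.norm_normalize (norm_pos_iff.1 (one_pos.trans_le hv))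
  have hw1 : ‖NormedSpace.normalize w‖ = 1 :=
    NormedSpace.norm_normalize (norm_pos_iff.1 (one_pos.trans_le hw))
  have hγ0 : 0 ≤ γ := (norm_nonneg _).trans (hγ _ hv1)
  calc _ ≤ 5 * d ^ 2 * γ * ‖NormedSpace.normalize w - NormedSpace.normalize v‖ :=
        norm_evalSys_sub_le hP hd hγ hv1 hw1
    _ ≤ 5 * d ^ 2 * γ * (2 * ‖w - v‖) := by
        gcongr
        exact norm_normalize_sub_normalize_le hw hv
    _ = 10 * d ^ 2 * γ * ‖w - v‖ := by ring

theorem exists_volume_eq_forall_norm_evalSys_le (hn : 2 ≤ n) (hP : ∀ j, (P j).totalDegree ≤ d)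
    (hd : 1 ≤ d) (hγ : ∀ x, ‖x‖ = 1 → ‖evalSys P x‖ ≤ γ) {x y : EuclideanSpace ℝ (Fin n)}
    (hx : ‖x‖ = 1) (hy : ‖y‖ = 1) (hxy : inner ℝ x y = 0) {α δ ε : ℝ} (hα : 0 ≤ α)
    (hδ0 : 0 ≤ δ) (hε0 : 0 ≤ ε) (hδ : d * δ ≤ 1 / 4) (hδγ : 3 * d ^ 3 * γ * δ ^ 2 ≤ α / 5)
    (hε : ε ≤ 1 / 4) (hεγ : 10 * d ^ 2 * γ * ε ≤ α / 2) (hPx : ‖evalSys P x‖ ≤ α)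
    (hPy : ‖dirDeriv P x y‖ ≤ √d * α) :
    ∃ S : Set (EuclideanSpace ℝ (Fin n)),
      volume S = ENNReal.ofReal (1 / 4 * δ * ε ^ (n - 2)) *
        volume (Metric.closedBall (0 : EuclideanSpace ℝ (Fin n)) 1) ∧
      ∀ w ∈ S, 1 ≤ ‖w‖ ∧ ‖w‖ ≤ 2 ∧ ‖evalSys P (NormedSpace.normalize w)‖ ≤ 2 * α := by
  have hγ0 : 0 ≤ γ := (norm_nonneg _).trans (hγ x hx)
  obtain ⟨S, hS, hSw⟩ := exists_volume_eq_forall_norm_sub_le hn hx hy hxy hδ0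
    ((le_mul_of_one_le_left hδ0 (by exact_mod_cast hd)).trans hδ) hε0 hε
  refine ⟨S, hS, fun w hwS => ?_⟩
  obtain ⟨hw1, hw2, l, t, hl, ht, hwv⟩ := hSw w hwS
  refine ⟨hw1, hw2, ?_⟩
  set v := l • x + t • y with hv
  have hv1 : 1 ≤ ‖v‖ := by
    have hxv : inner ℝ x v = l := by
      simp [hv, inner_add_right, inner_smul_right, hx, hxy]
    calc (1 : ℝ) ≤ inner ℝ x v := by rwa [hxv]
      _ ≤ ‖x‖ * ‖v‖ := real_inner_le_norm x v
      _ = ‖v‖ := by rw [hx, one_mul]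
  obtain ⟨θ, hθ, hvθ⟩ := exists_normalize_smul_add_smul_eq hx hy hxy (t := t) hl
  have hPv : ‖evalSys P (NormedSpace.normalize v)‖ ≤ 3 / 2 * α := by
    rw [hvθ]
    exact norm_evalSys_circle_le hP hd hγ hx hy hxy hα hδ hδγ hPx hPy (hθ.trans ht)
  have hdiff : ‖evalSys P (NormedSpace.normalize w) - evalSys P (NormedSpace.normalize v)‖
      ≤ α / 2 :=
    (norm_evalSys_normalize_sub_le hP hd hγ hv1 hw1).trans (le_trans (by gcongr) hεγ)
  linarith [norm_le_norm_add_norm_sub' (evalSys P (NormedSpace.normalize w))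
    (evalSys P (NormedSpace.normalize v))]

theorem continuous_evalSys (P : Fin m → MvPolynomial (Fin n) ℝ) : Continuous (evalSys P) :=
  (PiLp.continuous_toLp 2 _).comp <| continuous_pi fun j =>
    (MvPolynomial.continuous_eval (P j)).comp (PiLp.continuous_ofLp 2 _)

theorem exists_volume_eq_forall_le_norm_evalSys (hP : ∀ j, (P j).totalDegree ≤ d) (hd : 1 ≤ d)
    {g : ℝ} {x₀ : EuclideanSpace ℝ (Fin n)} (hx₀ : ‖x₀‖ = 1) (hg : g ≤ ‖evalSys P x₀‖) :
    ∃ S : Set (EuclideanSpace ℝ (Fin n)),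
      volume S = ENNReal.ofReal ((1 / (20 * d ^ 2)) ^ n) *
        volume (Metric.closedBall (0 : EuclideanSpace ℝ (Fin n)) 1) ∧
      ∀ w ∈ S, 1 ≤ ‖w‖ ∧ ‖w‖ ≤ 2 ∧ g / 2 ≤ ‖evalSys P (NormedSpace.normalize w)‖ := by
  obtain ⟨x, hx, hmax⟩ := (isCompact_sphere (0 : EuclideanSpace ℝ (Fin n)) 1).exists_isMaxOn
    ⟨x₀, by simpa using hx₀⟩ (continuous_evalSys P).norm.continuousOn
  have hx1 : ‖x‖ = 1 := by simpa using hx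
  have hγ : ∀ z, ‖z‖ = 1 → ‖evalSys P z‖ ≤ ‖evalSys P x‖ := fun z hz => hmax (by simpa using hz)
  have hd2 : (1 : ℝ) ≤ (d : ℝ) ^ 2 := one_le_pow₀ (by exact_mod_cast hd)
  set ρ : ℝ := 1 / (20 * d ^ 2) with hρ
  have hρ0 : 0 < ρ := by positivity
  have hρ1 : ρ ≤ 1 / 20 := one_div_le_one_div_of_le (by norm_num) (by linarith)
  have hcenter : ‖(5 / 4 : ℝ) • x‖ = 5 / 4 := by rw [norm_smul, hx1]; norm_num
  refine ⟨Metric.closedBall ((5 / 4 : ℝ) • x) ρ, ?_, fun w hw => ?_⟩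
  · rw [Measure.addHaar_closedBall' _ _ hρ0.le, finrank_euclideanSpace_fin]
  rw [mem_closedBall_iff_norm] at hw
  have hnorm := abs_le.1 ((abs_norm_sub_norm_le _ _).trans hw)
  have hw1 : 1 ≤ ‖w‖ := by linarith
  refine ⟨hw1, by linarith, ?_⟩
  have hcenter1 : 1 ≤ ‖(5 / 4 : ℝ) • x‖ := by rw [hcenter]; norm_num
  have hdiff := norm_evalSys_normalize_sub_le hP hd hγ hcenter1 hw1
  rw [NormedSpace.normalize_smul_of_pos (by norm_num),
    NormedSpace.normalize_eq_self_of_norm_eq_one hx1] at hdiff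
  have hhalf : 10 * d ^ 2 * ‖evalSys P x‖ * ‖w - (5 / 4 : ℝ) • x‖ ≤ ‖evalSys P x‖ / 2 :=
    calc _ ≤ 10 * d ^ 2 * ‖evalSys P x‖ * ρ := by gcongr
      _ = ‖evalSys P x‖ / 2 := by
          rw [hρ]
          field_simp
          ring
  linarith [hγ x₀ hx₀, norm_sub_norm_le (evalSys P x) (evalSys P (NormedSpace.normalize w)),
    norm_sub_rev (evalSys P x) (evalSys P (NormedSpace.normalize w))]

end LargeSets

section Probability

open scoped ENNReal

variable {Ω : Type*} [MeasurableSpace Ω] {μ : Measure Ω}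

/-- First moment argument: bound the expected `ν`-measure of the random section of `G`. -/
theorem mul_measure_le_of_le_measure_section {E : Type*} [MeasurableSpace E] [SFinite μ]
    (ν : Measure E) [SFinite ν] {G : Set (Ω × E)} (hG : MeasurableSet G) {T : Set E}
    (hT : MeasurableSet T) {p V : ℝ≥0∞} (hp : ∀ w ∈ T, μ {ω | (ω, w) ∈ G} ≤ p) {B : Set Ω}
    (hB : ∀ ω ∈ B, V ≤ ν {w | w ∈ T ∧ (ω, w) ∈ G}) : V * μ B ≤ p * ν T := by
  have hGT : MeasurableSet (G ∩ Prod.snd ⁻¹' T) := hG.inter (measurable_snd hT)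
  calc V * μ B ≤ V * μ {ω | V ≤ ν (Prod.mk ω ⁻¹' (G ∩ Prod.snd ⁻¹' T))} := by
        gcongr
        exact fun ω hω => (hB ω hω).trans (measure_mono fun w hw => ⟨hw.2, hw.1⟩)
    _ ≤ ∫⁻ ω, ν (Prod.mk ω ⁻¹' (G ∩ Prod.snd ⁻¹' T)) ∂μ :=
        mul_meas_ge_le_lintegral (measurable_measure_prodMk_left hGT) V
    _ = (μ.prod ν) (G ∩ Prod.snd ⁻¹' T) := (Measure.prod_apply hGT).symm
    _ = ∫⁻ w, μ ((fun ω => (ω, w)) ⁻¹' (G ∩ Prod.snd ⁻¹' T)) ∂ν := Measure.prod_apply_symm hGT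
    _ ≤ ∫⁻ w, T.indicator (fun _ => p) w ∂ν := by
        refine lintegral_mono fun w => ?_
        by_cases hw : w ∈ T
        · rw [Set.indicator_of_mem hw]
          exact (measure_mono fun ω hω => hω.1).trans (hp w hw)
        · rw [Set.indicator_of_notMem hw]
          exact (measure_mono_null (t := ∅) (fun ω hω => hw hω.2) measure_empty).le
    _ = p * ν T := by rw [lintegral_indicator_const hT]

theorem measure_le_sum_le_prod_lintegral_exp {ι : Type*} [Fintype ι] {Y : ι → Ω → ℝ}
    (hY : iIndepFun Y μ) (hm : ∀ i, Measurable (Y i)) (u : ℝ) :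
    μ {ω | u ≤ ∑ i, Y i ω} ≤
      ENNReal.ofReal (Real.exp (-u)) * ∏ i, ∫⁻ ω, ENNReal.ofReal (Real.exp (Y i ω)) ∂μ := by
  have hexp (ω : Ω) : ENNReal.ofReal (Real.exp (∑ i, Y i ω))
      = ∏ i, ENNReal.ofReal (Real.exp (Y i ω)) := by
    rw [Real.exp_sum, ENNReal.ofReal_prod_of_nonneg fun i _ => (Real.exp_pos _).le]
  have hmarkov := meas_ge_le_lintegral_div (μ := μ)
    (f := fun ω => ENNReal.ofReal (Real.exp (∑ i, Y i ω))) (by fun_prop)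
    (ENNReal.ofReal_pos.2 (Real.exp_pos u)).ne' ENNReal.ofReal_ne_top
  simp only [ENNReal.ofReal_le_ofReal_iff (Real.exp_pos _).le, Real.exp_le_exp] at hmarkov
  simp only [hexp] at hmarkov
  rw [lintegral_prod_eq_prod_lintegral_of_indepFun Finset.univ
    (fun i ω => ENNReal.ofReal (Real.exp (Y i ω)))
    (hY.comp (fun _ y => ENNReal.ofReal (Real.exp y)) fun _ => by fun_prop)
    (fun i => by fun_prop)] at hmarkov
  rwa [Real.exp_neg, ENNReal.ofReal_inv_of_pos (Real.exp_pos u), mul_comm, ← div_eq_mul_inv]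

theorem lintegral_exp_le_three [IsProbabilityMeasure μ] {f : Ω → ℝ} (hf : Measurable f)
    (hf0 : ∀ ω, 0 ≤ f ω)
    (htail : ∀ t : ℝ, 0 < t → μ {ω | t ≤ f ω} ≤ ENNReal.ofReal (2 * Real.exp (-(2 * t)))) :
    ∫⁻ ω, ENNReal.ofReal (Real.exp (f ω)) ∂μ ≤ 3 := by
  have hexp (ω : Ω) : ENNReal.ofReal (Real.exp (f ω))
      = ENNReal.ofReal (∫ t in (0 : ℝ)..f ω, Real.exp t) + 1 := by
    rw [integral_exp, Real.exp_zero, ← ENNReal.ofReal_one,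
      ← ENNReal.ofReal_add (sub_nonneg.2 (Real.one_le_exp (hf0 ω))) zero_le_one, sub_add_cancel]
  have htailint : ∫⁻ t in Set.Ioi (0 : ℝ), μ {a | t ≤ f a} * ENNReal.ofReal (Real.exp t) ≤ 2 :=
    calc ∫⁻ t in Set.Ioi (0 : ℝ), μ {a | t ≤ f a} * ENNReal.ofReal (Real.exp t)
        ≤ ∫⁻ t in Set.Ioi (0 : ℝ), ENNReal.ofReal (2 * Real.exp (-t)) := by
          refine setLIntegral_mono (by fun_prop) fun t ht => ?_
          refine (mul_le_mul_left (htail t ht) _).trans_eq ?_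
          rw [← ENNReal.ofReal_mul (by positivity), mul_assoc, ← Real.exp_add]
          congr 3
          ring
      _ = 2 := by
          rw [← ofReal_integral_eq_lintegral_ofReal ((integrableOn_exp_neg_Ioi 0).const_mul 2)
            (Filter.Eventually.of_forall fun t => by positivity), integral_const_mul,
            integral_exp_neg_Ioi_zero]
          norm_num
  simp only [hexp]
  rw [lintegral_add_right _ measurable_const, lintegral_const, measure_univ, one_mul,
    lintegral_comp_eq_lintegral_meas_le_mul μ (Filter.Eventually.of_forall hf0) hf.aemeasurable
      (fun t _ => Real.continuous_exp.intervalIntegrable _ _)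
      (Filter.Eventually.of_forall fun t => (Real.exp_pos t).le)]
  calc _ ≤ (2 : ℝ≥0∞) + 1 := by gcongr
    _ = 3 := by norm_num

section SmallBall

variable {Y : Ω → ℝ} {c₀ β : ℝ}

theorem measure_le_exp_neg_sq_le (hβ : 0 < β)
    (hball : ∀ ε : ℝ, 0 < ε → μ {ω | |Y ω| ≤ ε} ≤ ENNReal.ofReal (c₀ * ε)) {t : ℝ} (ht : 0 < t) :
    μ {ω | t ≤ Real.exp (-(Y ω ^ 2 / β ^ 2))} ≤ (Set.Ioc (0 : ℝ) 1).indicator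
      (fun t => ENNReal.ofReal (c₀ * β * t ^ (-(1 / 2) : ℝ))) t := by
  by_cases ht1 : t ≤ 1
  · rw [Set.indicator_of_mem (show t ∈ Set.Ioc (0 : ℝ) 1 from ⟨ht, ht1⟩), mul_assoc]
    refine (measure_mono fun ω hω => ?_).trans
      (hball (β * t ^ (-(1 / 2) : ℝ)) (mul_pos hβ (Real.rpow_pos_of_pos ht _)))
    have hlog : Real.log t ≤ -(Y ω ^ 2 / β ^ 2) := (Real.log_le_iff_le_exp ht).2 hω
    have hlog_inv : -Real.log t ≤ t⁻¹ := by
      rw [← Real.log_inv]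
      exact Real.log_le_self (inv_pos.2 ht).le
    have hsq : (t ^ (-(1 / 2) : ℝ)) ^ 2 = t⁻¹ := by
      rw [← Real.rpow_natCast, ← Real.rpow_mul ht.le, ← Real.rpow_neg_one]
      norm_num
    refine abs_le_of_sq_le_sq (b := β * t ^ (-(1 / 2) : ℝ)) ?_ (by positivity)
    rw [mul_pow, hsq, mul_comm, ← div_le_iff₀ (pow_pos hβ 2)]
    linarith
  · rw [Set.indicator_of_notMem fun h => ht1 h.2]
    refine (measure_mono_null (t := ∅) (fun ω hω => ht1 (le_trans hω ?_)) measure_empty).le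
    exact Real.exp_le_one_iff.2 (neg_nonpos.2 (by positivity))

theorem lintegral_exp_neg_sq_le (hY : Measurable Y) (hβ : 0 < β) (hc₀ : 0 ≤ c₀)
    (hball : ∀ ε : ℝ, 0 < ε → μ {ω | |Y ω| ≤ ε} ≤ ENNReal.ofReal (c₀ * ε)) :
    ∫⁻ ω, ENNReal.ofReal (Real.exp (-(Y ω ^ 2 / β ^ 2))) ∂μ ≤ ENNReal.ofReal (2 * c₀ * β) := by
  have hint : IntegrableOn (fun t : ℝ => t ^ (-(1 / 2) : ℝ)) (Set.Ioc 0 1) :=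
    (intervalIntegrable_iff_integrableOn_Ioc_of_le zero_le_one).1
      (intervalIntegral.intervalIntegrable_rpow' (by norm_num))
  have hnonneg : (0 : ℝ → ℝ) ≤ᵐ[volume.restrict (Set.Ioc 0 1)]
      fun t : ℝ => c₀ * β * t ^ (-(1 / 2) : ℝ) :=
    (ae_restrict_iff' measurableSet_Ioc).2 (Filter.Eventually.of_forall fun t ht =>
      mul_nonneg (by positivity) (Real.rpow_nonneg ht.1.le _))
  calc ∫⁻ ω, ENNReal.ofReal (Real.exp (-(Y ω ^ 2 / β ^ 2))) ∂μ
      = ∫⁻ t in Set.Ioi (0 : ℝ), μ {ω | t ≤ Real.exp (-(Y ω ^ 2 / β ^ 2))} :=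
        lintegral_eq_lintegral_meas_le μ
          (Filter.Eventually.of_forall fun ω => (Real.exp_pos _).le) (by fun_prop)
    _ ≤ ∫⁻ t in Set.Ioi (0 : ℝ), (Set.Ioc (0 : ℝ) 1).indicator
          (fun t => ENNReal.ofReal (c₀ * β * t ^ (-(1 / 2) : ℝ))) t :=
        setLIntegral_mono (Measurable.indicator (by fun_prop) measurableSet_Ioc)
          fun t ht => measure_le_exp_neg_sq_le hβ hball ht
    _ = ∫⁻ t in Set.Ioc (0 : ℝ) 1, ENNReal.ofReal (c₀ * β * t ^ (-(1 / 2) : ℝ)) := by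
        rw [lintegral_indicator measurableSet_Ioc, Measure.restrict_restrict measurableSet_Ioc,
          Set.inter_eq_left.2 Set.Ioc_subset_Ioi_self]
    _ = ENNReal.ofReal (2 * c₀ * β) := by
        rw [← ofReal_integral_eq_lintegral_ofReal (hint.const_mul _) hnonneg, integral_const_mul,
          ← intervalIntegral.integral_of_le zero_le_one, integral_rpow (Or.inl (by norm_num))]
        norm_num
        ring_nf

end SmallBall

variable {ι : Type*} [Fintype ι] {X : Ω → EuclideanSpace ℝ ι} {K : ℝ}

theorem SubGaussianVec.measure_le [IsProbabilityMeasure μ] (h : SubGaussianVec μ X K)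
    {θ : EuclideanSpace ℝ ι} (hθ : ‖θ‖ ≤ 1) {t : ℝ} (ht : 0 < t) :
    μ {ω | t ≤ |inner ℝ (X ω) θ|} ≤ ENNReal.ofReal (2 * Real.exp (-t ^ 2 / K ^ 2)) := by
  rcases eq_or_ne θ 0 with rfl | hθ0
  · simp [ht.not_ge]
  · have hunit := NormedSpace.norm_normalize hθ0
    rw [← ofReal_measureReal (measure_ne_top _ _)]
    refine ENNReal.ofReal_le_ofReal ((measureReal_mono fun ω hω => ?_).trans (h _ hunit t ht))
    calc t ≤ |inner ℝ (X ω) θ| := hω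
      _ = ‖θ‖ * |inner ℝ (X ω) (NormedSpace.normalize θ)| := by
          conv_lhs => rw [← NormedSpace.norm_smul_normalize θ]
          rw [inner_smul_right, abs_mul, abs_norm]
      _ ≤ |inner ℝ (X ω) (NormedSpace.normalize θ)| := mul_le_of_le_one_left (abs_nonneg _) hθ

theorem SubGaussianVec.lintegral_exp_inner_sq_le [IsProbabilityMeasure μ] (hK : 0 < K)
    (h : SubGaussianVec μ X K) (hX : Measurable X) {θ : EuclideanSpace ℝ ι} (hθ : ‖θ‖ ≤ 1) :
    ∫⁻ ω, ENNReal.ofReal (Real.exp (inner ℝ (X ω) θ ^ 2 / (2 * K ^ 2))) ∂μ ≤ 3 := by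
  refine lintegral_exp_le_three (by fun_prop) (fun ω => by positivity) fun t ht => ?_
  have hsq : (√(2 * t) * K) ^ 2 = 2 * t * K ^ 2 := by
    rw [mul_pow, Real.sq_sqrt (by positivity)]
  have htail := h.measure_le hθ (t := √(2 * t) * K) (by positivity)
  rw [hsq, neg_div, mul_div_cancel_right₀ _ (by positivity)] at htail
  refine (measure_mono fun ω hω => ?_).trans htail
  refine (le_abs_self (√(2 * t) * K)).trans (sq_le_sq.1 ?_)
  rw [hsq]
  have hω' : t * (2 * K ^ 2) ≤ inner ℝ (X ω) θ ^ 2 := (le_div_iff₀ (by positivity)).1 hω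
  linarith

theorem half_norm_le_inner_of_mem_closedBall {E : Type*} [NormedAddCommGroup E]
    [InnerProductSpace ℝ E] {c θ : E}
    (hθ : θ ∈ Metric.closedBall ((3 / 4 : ℝ) • NormedSpace.normalize c) (1 / 4)) :
    ‖c‖ / 2 ≤ inner ℝ c θ := by
  rw [mem_closedBall_iff_norm] at hθ
  have hcenter : inner ℝ c (NormedSpace.normalize c) = ‖c‖ := by
    rcases eq_or_ne c 0 with rfl | hc
    · simp
    · rw [NormedSpace.normalize, inner_smul_right, real_inner_self_eq_norm_sq]
      field_simp
  have hdiff : |inner ℝ c (θ - (3 / 4 : ℝ) • NormedSpace.normalize c)| ≤ ‖c‖ * (1 / 4) :=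
    (abs_real_inner_le_norm _ _).trans (by gcongr)
  rw [inner_sub_right, inner_smul_right, hcenter] at hdiff
  linarith [(abs_le.1 hdiff).1]

theorem volume_mul_exp_norm_sq_le (K : ℝ) (c : EuclideanSpace ℝ ι) :
    volume (Metric.closedBall (0 : EuclideanSpace ℝ ι) 1) *
        ENNReal.ofReal (Real.exp (‖c‖ ^ 2 / (8 * K ^ 2))) ≤
      4 ^ Fintype.card ι * ∫⁻ θ in Metric.closedBall (0 : EuclideanSpace ℝ ι) 1,
        ENNReal.ofReal (Real.exp (inner ℝ c θ ^ 2 / (2 * K ^ 2))) := by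
  set u := (3 / 4 : ℝ) • NormedSpace.normalize c with hu
  have hvol : volume (Metric.closedBall (0 : EuclideanSpace ℝ ι) 1)
      = 4 ^ Fintype.card ι * volume (Metric.closedBall u (1 / 4)) := by
    rw [Measure.addHaar_closedBall' _ u (by norm_num : (0 : ℝ) ≤ 1 / 4), finrank_euclideanSpace,
      ← mul_assoc, ENNReal.ofReal_pow (by norm_num), ← mul_pow, ← ENNReal.ofReal_ofNat 4,
      ← ENNReal.ofReal_mul (by norm_num)]
    norm_num
  have hsub : Metric.closedBall u (1 / 4) ⊆ Metric.closedBall 0 1 := by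
    refine Metric.closedBall_subset_closedBall' ?_
    have hnorm : ‖NormedSpace.normalize c‖ ≤ 1 := by
      rw [NormedSpace.normalize, norm_smul, norm_inv, norm_norm]
      exact inv_mul_le_one
    rw [dist_zero_right, hu, norm_smul, Real.norm_of_nonneg (by norm_num)]
    linarith
  calc _ = 4 ^ Fintype.card ι * ∫⁻ _ in Metric.closedBall u (1 / 4),
            ENNReal.ofReal (Real.exp (‖c‖ ^ 2 / (8 * K ^ 2))) := by
          rw [setLIntegral_const, hvol]
          ring
    _ ≤ 4 ^ Fintype.card ι * ∫⁻ θ in Metric.closedBall u (1 / 4),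
            ENNReal.ofReal (Real.exp (inner ℝ c θ ^ 2 / (2 * K ^ 2))) := by
          gcongr 4 ^ Fintype.card ι * ?_
          refine setLIntegral_mono (by fun_prop) fun θ hθ => ?_
          have hhalf := half_norm_le_inner_of_mem_closedBall hθ
          have hrw : ‖c‖ ^ 2 / (8 * K ^ 2) = (‖c‖ / 2) ^ 2 / (2 * K ^ 2) := by
            rw [div_pow, div_div, ← mul_assoc]
            norm_num
          rw [hrw]
          gcongr
    _ ≤ _ := by gcongr

/-- Averaging over the directions `θ` reduces the norm of `X` to its one-dimensional marginals. -/
theorem SubGaussianVec.lintegral_exp_norm_sq_le [IsProbabilityMeasure μ] (hK : 0 < K)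
    (h : SubGaussianVec μ X K) (hX : Measurable X) :
    ∫⁻ ω, ENNReal.ofReal (Real.exp (‖X ω‖ ^ 2 / (8 * K ^ 2))) ∂μ
      ≤ 3 * 4 ^ Fintype.card ι := by
  set B : Set (EuclideanSpace ℝ ι) := Metric.closedBall 0 1 with hB
  have hB0 : volume B ≠ 0 := (Metric.measure_closedBall_pos volume _ one_pos).ne'
  have hBt : volume B ≠ ∞ := measure_closedBall_lt_top.ne
  refine (ENNReal.mul_le_mul_iff_right hB0 hBt).1 ?_
  calc volume B * ∫⁻ ω, ENNReal.ofReal (Real.exp (‖X ω‖ ^ 2 / (8 * K ^ 2))) ∂μ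
      = ∫⁻ ω, volume B * ENNReal.ofReal (Real.exp (‖X ω‖ ^ 2 / (8 * K ^ 2))) ∂μ :=
        (lintegral_const_mul _ (by fun_prop)).symm
    _ ≤ ∫⁻ ω, 4 ^ Fintype.card ι *
          (∫⁻ θ in B, ENNReal.ofReal (Real.exp (inner ℝ (X ω) θ ^ 2 / (2 * K ^ 2)))) ∂μ :=
        lintegral_mono fun ω => volume_mul_exp_norm_sq_le K (X ω)
    _ = 4 ^ Fintype.card ι * ∫⁻ θ in B,
          ∫⁻ ω, ENNReal.ofReal (Real.exp (inner ℝ (X ω) θ ^ 2 / (2 * K ^ 2))) ∂μ := by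
        rw [lintegral_const_mul' _ _ (by simp), lintegral_lintegral_swap]
        refine Measurable.aemeasurable ?_
        simp only [Function.uncurry_def]
        fun_prop
    _ ≤ 4 ^ Fintype.card ι * ∫⁻ _ in B, 3 := by
        gcongr 4 ^ Fintype.card ι * ?_
        refine setLIntegral_mono measurable_const fun θ hθ => ?_
        exact h.lintegral_exp_inner_sq_le hK hX (by simpa [hB] using hθ)
    _ = volume B * (3 * 4 ^ Fintype.card ι) := by
        rw [setLIntegral_const]
        ring

theorem SmallBallVec.lintegral_exp_neg_inner_sq_le [IsProbabilityMeasure μ] {c₀ : ℝ}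
    (hc₀ : 0 ≤ c₀) (h : SmallBallVec μ X c₀) (hX : Measurable X) {a : EuclideanSpace ℝ ι}
    (ha : ‖a‖ = 1) {β : ℝ} (hβ : 0 < β) :
    ∫⁻ ω, ENNReal.ofReal (Real.exp (-(inner ℝ (X ω) a ^ 2 / β ^ 2))) ∂μ
      ≤ ENNReal.ofReal (2 * c₀ * β) := by
  refine lintegral_exp_neg_sq_le (by fun_prop) hβ hc₀ fun ε hε => ?_
  rw [← ofReal_measureReal (measure_ne_top _ _)]
  simpa only [ha, mul_one, real_inner_comm] using
    ENNReal.ofReal_le_ofReal (h a (norm_ne_zero_iff.1 (ha ▸ one_ne_zero)) ε hε)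

end Probability

section System

open scoped ENNReal

theorem measureReal_le_of_forall_exists_measure_eq {Ω E : Type*} [MeasurableSpace Ω]
    {μ : Measure Ω} [IsFiniteMeasure μ] [NormedAddCommGroup E] [NormedSpace ℝ E]
    [FiniteDimensional ℝ E] [MeasurableSpace E] [BorelSpace E] (ν : Measure E)
    [ν.IsAddHaarMeasure] {G : Set (Ω × E)} (hG : MeasurableSet G) {p v : ℝ} (hp0 : 0 ≤ p)
    (hv : 0 < v) (hp : ∀ w, 1 ≤ ‖w‖ → μ {ω | (ω, w) ∈ G} ≤ ENNReal.ofReal p) {B : Set Ω}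
    (hB : ∀ ω ∈ B, ∃ S : Set E, ν S = ENNReal.ofReal v * ν (Metric.closedBall (0 : E) 1) ∧
      ∀ w ∈ S, 1 ≤ ‖w‖ ∧ ‖w‖ ≤ 2 ∧ (ω, w) ∈ G) :
    μ.real B ≤ p * 2 ^ Module.finrank ℝ E / v := by
  set b := ν (Metric.closedBall (0 : E) 1) with hb
  have hb0 : b ≠ 0 := (Metric.measure_closedBall_pos ν _ one_pos).ne'
  have hbt : b ≠ ∞ := measure_closedBall_lt_top.ne
  have hannulus : MeasurableSet {w : E | 1 ≤ ‖w‖ ∧ ‖w‖ ≤ 2} :=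
    (measurableSet_le measurable_const measurable_norm).inter
      (measurableSet_le measurable_norm measurable_const)
  have hmoment := mul_measure_le_of_le_measure_section ν hG hannulus (fun w hw => hp w hw.1)
    (V := ENNReal.ofReal v * b) fun ω hω => by
      obtain ⟨S, hS, hSG⟩ := hB ω hω
      rw [← hS]
      exact measure_mono fun w hw => ⟨⟨(hSG w hw).1, (hSG w hw).2.1⟩, (hSG w hw).2.2⟩
  have hvol : ν {w : E | 1 ≤ ‖w‖ ∧ ‖w‖ ≤ 2} ≤ ENNReal.ofReal (2 ^ Module.finrank ℝ E) * b := by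
    rw [hb, ← Measure.addHaar_closedBall' ν (0 : E) zero_le_two]
    exact measure_mono fun w hw => by simpa using hw.2
  have hscaled : b * (ENNReal.ofReal v * μ B)
      ≤ b * ENNReal.ofReal (p * 2 ^ Module.finrank ℝ E) :=
    calc b * (ENNReal.ofReal v * μ B) = ENNReal.ofReal v * b * μ B := by ring
      _ ≤ ENNReal.ofReal p * (ENNReal.ofReal (2 ^ Module.finrank ℝ E) * b) :=
          hmoment.trans (by gcongr)
      _ = b * ENNReal.ofReal (p * 2 ^ Module.finrank ℝ E) := by
          rw [ENNReal.ofReal_mul hp0]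
          ring
  have hcancel := (ENNReal.mul_le_mul_iff_right hb0 hbt).1 hscaled
  rw [← ofReal_measureReal (measure_ne_top _ _), ← ENNReal.ofReal_mul hv.le,
    ENNReal.ofReal_le_ofReal_iff (by positivity)] at hcancel
  rwa [le_div_iff₀ hv, mul_comm]

theorem one_fourth_le_mul_of_subGaussianVec_of_smallBallVec {Ω ι : Type*} [MeasurableSpace Ω]
    [Fintype ι] [Nonempty ι] {μ : Measure Ω} [IsProbabilityMeasure μ]
    {X : Ω → EuclideanSpace ℝ ι} {K c₀ : ℝ} (hK : 0 < K) (hsg : SubGaussianVec μ X K)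
    (hsb : SmallBallVec μ X c₀) : 1 / 4 ≤ K * c₀ := by
  obtain ⟨θ, hθ⟩ := exists_norm_eq (EuclideanSpace ℝ ι) zero_le_one
  have hlarge := hsg θ hθ (2 * K) (by linarith)
  have hsmall := hsb θ (norm_ne_zero_iff.1 (hθ ▸ one_ne_zero)) (2 * K) (by linarith)
  rw [hθ, mul_one] at hsmall
  have hcover : (1 : ℝ) ≤ μ.real {ω | 2 * K ≤ |inner ℝ (X ω) θ|}
      + μ.real {ω | |inner ℝ θ (X ω)| ≤ 2 * K} := by
    rw [← probReal_univ (μ := μ)]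
    refine (measureReal_mono fun ω _ => ?_).trans (measureReal_union_le _ _)
    rcases le_total (2 * K) |inner ℝ (X ω) θ| with h | h
    · exact Or.inl h
    · exact Or.inr (by rwa [real_inner_comm] at h)
  have hexponent : -(2 * K) ^ 2 / K ^ 2 = -4 := by
    field_simp
    norm_num
  have hexp : Real.exp (-4) ≤ 1 / 4 := by
    rw [Real.exp_neg, one_div]
    exact inv_anti₀ (by norm_num) (by linarith [Real.add_one_le_exp (4 : ℝ)])
  rw [hexponent] at hlarge
  linarith

variable {n m : ℕ} {deg : Fin m → ℕ} {Ω : Type*} [MeasurableSpace Ω] {μ : Measure Ω}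
  {X : ∀ j : Fin m, Ω → EuclideanSpace ℝ (WExp n (deg j))} {K c₀ : ℝ}

theorem measurable_evalSys_weylPoly_normalize (hX : ∀ j, Measurable (X j)) :
    Measurable fun p : Ω × EuclideanSpace ℝ (Fin n) =>
      evalSys (fun j => weylPoly (X j p.1)) (NormedSpace.normalize p.2) := by
  have hnormalize : Measurable fun p : Ω × EuclideanSpace ℝ (Fin n) =>
      NormedSpace.normalize p.2 := by
    unfold NormedSpace.normalize
    fun_prop
  refine (WithLp.measurable_toLp 2 _).comp (measurable_pi_lambda _ fun j => ?_)
  simp only [eval_weylPoly]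
  exact ((hX j).comp measurable_fst).inner ((continuous_weylVec _).measurable.comp hnormalize)

variable [IsProbabilityMeasure μ]

theorem measure_le_norm_evalSys_le (hX : ∀ j, Measurable (X j)) (hind : iIndepFun X μ)
    (hK : 0 < K) (hsg : ∀ j, SubGaussianVec μ (X j) K) {x : EuclideanSpace ℝ (Fin n)}
    (hx : ‖x‖ = 1) {g : ℝ} (hg : 0 ≤ g) :
    μ {ω | g ≤ ‖evalSys (fun j => weylPoly (X j ω)) x‖} ≤
      ENNReal.ofReal (Real.exp (-(g ^ 2 / (2 * K ^ 2))) * 3 ^ m) := by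
  have hchernoff := measure_le_sum_le_prod_lintegral_exp
    (Y := fun j ω => inner ℝ (X j ω) (weylVec (deg j) x) ^ 2 / (2 * K ^ 2))
    (hind.comp (fun j c => inner ℝ c (weylVec (deg j) x) ^ 2 / (2 * K ^ 2)) fun j => by fun_prop)
    (fun j => by have := hX j; fun_prop) (g ^ 2 / (2 * K ^ 2))
  refine (measure_mono fun ω hω => ?_).trans (hchernoff.trans ?_)
  · simp only [Set.mem_ofPred_eq] at hω ⊢
    rw [← Finset.sum_div, ← norm_evalSys_weylPoly_sq]
    gcongr
  · rw [ENNReal.ofReal_mul (Real.exp_pos _).le, ENNReal.ofReal_pow (by norm_num)]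
    gcongr
    refine (Finset.prod_le_pow_card _ _ 3 fun j _ => ?_).trans (by simp)
    exact (hsg j).lintegral_exp_inner_sq_le hK (hX j) (by rw [norm_weylVec, hx, one_pow])

theorem measure_norm_evalSys_le_le (hm : 1 ≤ m) (hX : ∀ j, Measurable (X j))
    (hind : iIndepFun X μ) (hc₀ : 0 ≤ c₀) (hsb : ∀ j, SmallBallVec μ (X j) c₀)
    {x : EuclideanSpace ℝ (Fin n)} (hx : ‖x‖ = 1) {b : ℝ} (hb : 0 < b) :
    μ {ω | ‖evalSys (fun j => weylPoly (X j ω)) x‖ ≤ b} ≤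
      ENNReal.ofReal ((2 * Real.exp 1 * c₀ * b / √m) ^ m) := by
  have hm0 : (0 : ℝ) < m := by exact_mod_cast hm
  set β : ℝ := b / √m with hβ
  have hβ0 : 0 < β := by positivity
  have hchernoff := measure_le_sum_le_prod_lintegral_exp
    (Y := fun j ω => -(inner ℝ (X j ω) (weylVec (deg j) x) ^ 2 / β ^ 2))
    (hind.comp (fun j c => -(inner ℝ c (weylVec (deg j) x) ^ 2 / β ^ 2)) fun j => by fun_prop)
    (fun j => by have := hX j; fun_prop) (-m)
  refine (measure_mono fun ω hω => ?_).trans (hchernoff.trans ?_)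
  · simp only [Set.mem_ofPred_eq] at hω ⊢
    rw [Finset.sum_neg_distrib, ← Finset.sum_div, ← norm_evalSys_weylPoly_sq, neg_le_neg_iff,
      div_le_iff₀ (by positivity), hβ, div_pow, Real.sq_sqrt hm0.le, mul_div_cancel₀ _ hm0.ne']
    gcongr
  · have hsplit : (2 * Real.exp 1 * c₀ * b / √m) ^ m = Real.exp (- -m) * (2 * c₀ * β) ^ m := by
      rw [neg_neg, ← mul_one (m : ℝ), Real.exp_nat_mul, ← mul_pow, hβ, mul_one]
      congr 1
      ring
    rw [hsplit, ENNReal.ofReal_mul (Real.exp_pos _).le, ENNReal.ofReal_pow (by positivity)]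
    gcongr
    refine (Finset.prod_le_pow_card _ _ (ENNReal.ofReal (2 * c₀ * β)) fun j _ => ?_).trans
      (by simp)
    exact (hsb j).lintegral_exp_neg_inner_sq_le hc₀ (hX j) (by rw [norm_weylVec, hx, one_pow]) hβ0

/-- The number `N` of coefficients of a system of `m` homogeneous polynomials of degrees `deg` in
`n` variables. -/
def coeffDim (n : ℕ) {m : ℕ} (deg : Fin m → ℕ) : ℕ :=
  ∑ j, (n + deg j - 1).choose (deg j)

theorem le_coeffDim (hn : 1 ≤ n) (deg : Fin m → ℕ) : m ≤ coeffDim n deg := by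
  simpa [coeffDim] using Finset.card_nsmul_le_sum Finset.univ
    (fun j => (n + deg j - 1).choose (deg j)) 1 fun j _ => Nat.choose_pos (by lia)

theorem measureReal_le_weylNormSys_le (hn : 1 ≤ n) (hX : ∀ j, Measurable (X j))
    (hind : iIndepFun X μ) (hK : 0 < K) (hsg : ∀ j, SubGaussianVec μ (X j) K) {u : ℝ}
    (hu : 0 ≤ u) :
    μ.real {ω | √(8 * u) * K ≤ weylNormSys deg fun j => weylPoly (X j ω)}
      ≤ Real.exp (-u) * 12 ^ coeffDim n deg := by
  have hchernoff := measure_le_sum_le_prod_lintegral_exp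
    (Y := fun j ω => ‖X j ω‖ ^ 2 / (8 * K ^ 2))
    (hind.comp (fun j c => ‖c‖ ^ 2 / (8 * K ^ 2)) fun j => by fun_prop)
    (fun j => by have := hX j; fun_prop) u
  have hprod : ∏ j, ∫⁻ ω, ENNReal.ofReal (Real.exp (‖X j ω‖ ^ 2 / (8 * K ^ 2))) ∂μ
      ≤ ENNReal.ofReal (12 ^ coeffDim n deg) := by
    rw [ENNReal.ofReal_pow (by norm_num), coeffDim, ← Finset.prod_pow_eq_pow_sum]
    refine Finset.prod_le_prod' fun j _ => ?_
    refine ((hsg j).lintegral_exp_norm_sq_le hK (hX j)).trans ?_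
    rw [card_wExp, show ENNReal.ofReal 12 = 3 * 4 by norm_num, mul_pow]
    gcongr
    exact le_self_pow₀ (by norm_num) (Nat.choose_pos (by lia)).ne'
  refine ENNReal.toReal_le_of_le_ofReal (by positivity) ?_
  rw [ENNReal.ofReal_mul (Real.exp_pos _).le]
  refine (measure_mono fun ω hω => ?_).trans (hchernoff.trans (by gcongr))
  simp only [Set.mem_ofPred_eq, weylNormSys_weylPoly] at hω ⊢
  have hsq := (Real.le_sqrt (by positivity) (by positivity)).1 hω
  rw [mul_pow, Real.sq_sqrt (by positivity)] at hsq
  rw [← Finset.sum_div, le_div_iff₀ (by positivity)]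
  linarith

variable {d : ℕ}

theorem measureReal_exists_le_norm_evalSys_le (hd : 1 ≤ d) (hdeg : ∀ j, deg j ≤ d)
    (hX : ∀ j, Measurable (X j)) (hind : iIndepFun X μ) (hK : 0 < K)
    (hsg : ∀ j, SubGaussianVec μ (X j) K) {g : ℝ} (hg : 0 ≤ g) :
    μ.real {ω | ∃ x, ‖x‖ = 1 ∧ g ≤ ‖evalSys (fun j => weylPoly (X j ω)) x‖}
      ≤ Real.exp (-(g ^ 2 / (8 * K ^ 2))) * 3 ^ m * (40 * d ^ 2) ^ n := by
  refine le_trans (measureReal_le_of_forall_exists_measure_eq volume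
    (measurableSet_le (measurable_const (a := g / 2))
      (measurable_evalSys_weylPoly_normalize hX).norm)
    (p := Real.exp (-((g / 2) ^ 2 / (2 * K ^ 2))) * 3 ^ m) (v := (1 / (20 * d ^ 2)) ^ n)
    (by positivity) (by positivity)
    (fun w hw => measure_le_norm_evalSys_le hX hind hK hsg
      (NormedSpace.norm_normalize (norm_pos_iff.1 (one_pos.trans_le hw))) (by positivity))
    fun ω ⟨x, hx, hgx⟩ => exists_volume_eq_forall_le_norm_evalSys
      (fun j => (totalDegree_weylPoly_le (X j ω)).trans (hdeg j)) hd hx hgx) (le_of_eq ?_)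
  have hexponent : (g / 2) ^ 2 / (2 * K ^ 2) = g ^ 2 / (8 * K ^ 2) := by
    rw [div_pow, div_div]
    ring_nf
  rw [hexponent, finrank_euclideanSpace_fin, mul_div_assoc, ← div_pow, div_div_eq_mul_div]
  ring

/-- At scale `γ` for the supremum and `α` for the small values, the optimal ellipsoid has one
semi-axis of order `√(α / γ)`, along the direction of the small derivative, and `n - 2` semi-axes
of order `α / γ`. -/
theorem exists_volume_eq_forall_norm_evalSys_le_of_le (hn : 2 ≤ n)
    {P : Fin m → MvPolynomial (Fin n) ℝ} (hP : ∀ j, (P j).totalDegree ≤ d) (hd : 1 ≤ d)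
    {α γ : ℝ} (hα : 0 < α) (hαγ : α ≤ γ) (hγ : ∀ x, ‖x‖ = 1 → ‖evalSys P x‖ ≤ γ)
    {x y : EuclideanSpace ℝ (Fin n)} (hx : ‖x‖ = 1) (hy : ‖y‖ = 1) (hxy : inner ℝ x y = 0)
    (hPx : ‖evalSys P x‖ ≤ α) (hPy : ‖dirDeriv P x y‖ ≤ √d * α) :
    ∃ S : Set (EuclideanSpace ℝ (Fin n)),
      volume S = ENNReal.ofReal
          (1 / 4 * (√(α / γ) / (4 * d ^ 2)) * (α / γ / (20 * d ^ 2)) ^ (n - 2)) *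
        volume (Metric.closedBall (0 : EuclideanSpace ℝ (Fin n)) 1) ∧
      ∀ w ∈ S, 1 ≤ ‖w‖ ∧ ‖w‖ ≤ 2 ∧ ‖evalSys P (NormedSpace.normalize w)‖ ≤ 2 * α := by
  have hγ0 : 0 < γ := hα.trans_le hαγ
  have hd' : (1 : ℝ) ≤ d := by exact_mod_cast hd
  have hd2 : (1 : ℝ) ≤ (d : ℝ) ^ 2 := one_le_pow₀ hd'
  have hratio : α / γ ≤ 1 := (div_le_one hγ0).2 hαγ
  refine exists_volume_eq_forall_norm_evalSys_le hn hP hd hγ hx hy hxy hα.le (by positivity)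
    (by positivity) ?_ ?_ ?_ ?_ hPx hPy
  · calc d * (√(α / γ) / (4 * d ^ 2)) = √(α / γ) / (4 * d) := by field_simp
      _ ≤ 1 / (4 * 1) := by
          gcongr
          exact Real.sqrt_le_one.2 hratio
      _ = 1 / 4 := by norm_num
  · calc 3 * d ^ 3 * γ * (√(α / γ) / (4 * d ^ 2)) ^ 2 = 3 / 16 * (α / d) := by
          rw [div_pow, Real.sq_sqrt (by positivity)]
          field_simp
          norm_num
      _ ≤ 3 / 16 * (α / 1) := by gcongr
      _ ≤ α / 5 := by linarith
  · calc α / γ / (20 * d ^ 2) ≤ 1 / (20 * 1) := by gcongr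
      _ ≤ 1 / 4 := by norm_num
  · refine le_of_eq ?_
    field_simp
    norm_num

theorem two_pow_div_le_mul_rpow (hn : 2 ≤ n) {D a : ℝ} (hD : 1 ≤ D) (ha : 0 < a) :
    2 ^ n / (1 / 4 * (√a / (4 * D)) * (a / (20 * D)) ^ (n - 2))
      ≤ (40 * D) ^ n * a⁻¹ ^ ((n : ℝ) - 3 / 2) := by
  obtain ⟨k, rfl⟩ : ∃ k, n = k + 2 := ⟨n - 2, by lia⟩
  have hrpow : a⁻¹ ^ (((k + 2 : ℕ) : ℝ) - 3 / 2) = 1 / (√a * a ^ k) := by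
    rw [Real.inv_rpow ha.le, Real.sqrt_eq_rpow, ← Real.rpow_natCast a k, ← Real.rpow_add ha,
      one_div]
    congr 2
    push_cast
    ring
  have hpow : (40 * D) ^ k = 2 ^ k * (20 * D) ^ k := by
    rw [← mul_pow]
    ring
  rw [hrpow, Nat.add_sub_cancel]
  calc 2 ^ (k + 2) / (1 / 4 * (√a / (4 * D)) * (a / (20 * D)) ^ k)
      = 64 * D * (40 * D) ^ k * (1 / (√a * a ^ k)) := by
        rw [hpow, div_pow]
        field_simp
        ring
    _ ≤ 1600 * D ^ 2 * (40 * D) ^ k * (1 / (√a * a ^ k)) := by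
        gcongr ?_ * _ * _
        nlinarith
    _ = (40 * D) ^ (k + 2) * (1 / (√a * a ^ k)) := by ring

theorem measureReal_exists_norm_evalSys_norm_dirDeriv_le_le (hn : 2 ≤ n) (hm : 1 ≤ m)
    (hd : 1 ≤ d) (hdeg : ∀ j, deg j ≤ d) (hX : ∀ j, Measurable (X j)) (hind : iIndepFun X μ)
    (hc₀ : 0 ≤ c₀) (hsb : ∀ j, SmallBallVec μ (X j) c₀) {α γ : ℝ} (hα : 0 < α) (hαγ : α ≤ γ) :
    μ.real {ω | (∀ x, ‖x‖ = 1 → ‖evalSys (fun j => weylPoly (X j ω)) x‖ ≤ γ) ∧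
        ∃ x y : EuclideanSpace ℝ (Fin n), ‖x‖ = 1 ∧ ‖y‖ = 1 ∧ inner ℝ x y = 0 ∧
          ‖evalSys (fun j => weylPoly (X j ω)) x‖ ≤ α ∧
          ‖dirDeriv (fun j => weylPoly (X j ω)) x y‖ ≤ √d * α}
      ≤ (4 * Real.exp 1 * c₀ * α / √m) ^ m * (40 * d ^ 2) ^ n
        * (γ / α) ^ ((n : ℝ) - 3 / 2) := by
  have hγ0 : 0 < γ := hα.trans_le hαγ
  refine le_trans (measureReal_le_of_forall_exists_measure_eq volume
    (measurableSet_le (measurable_evalSys_weylPoly_normalize hX).norm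
      (measurable_const (a := 2 * α)))
    (p := (2 * Real.exp 1 * c₀ * (2 * α) / √m) ^ m)
    (v := 1 / 4 * (√(α / γ) / (4 * d ^ 2)) * (α / γ / (20 * d ^ 2)) ^ (n - 2))
    (by positivity) (by positivity)
    (fun w hw => measure_norm_evalSys_le_le hm hX hind hc₀ hsb
      (NormedSpace.norm_normalize (norm_pos_iff.1 (one_pos.trans_le hw))) (by positivity))
    fun ω ⟨hγ, x, y, hx, hy, hxy, hPx, hPy⟩ => exists_volume_eq_forall_norm_evalSys_le_of_le hn
      (fun j => (totalDegree_weylPoly_le (X j ω)).trans (hdeg j)) hd hα hαγ hγ hx hy hxy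
      hPx hPy) ?_
  have hvol := two_pow_div_le_mul_rpow hn (D := (d : ℝ) ^ 2)
    (one_le_pow₀ (by exact_mod_cast hd)) (div_pos hα hγ0)
  rw [inv_div] at hvol
  have hconst : 2 * Real.exp 1 * c₀ * (2 * α) = 4 * Real.exp 1 * c₀ * α := by ring
  rw [finrank_euclideanSpace_fin, mul_div_assoc, hconst, mul_assoc (_ ^ m)]
  gcongr

end System

section Constants

/-- The exponent `r = m - n + 3/2` of the power law decay of the tail. -/
noncomputable def decayExponent (n m : ℕ) : ℝ :=
  (m : ℝ) - n + 3 / 2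

/-- The threshold `ℓ = m log (e d)` for the tail of the supremum over the sphere. -/
noncomputable def logDim (m : ℕ) (d : ℝ) : ℝ :=
  m * Real.log (Real.exp 1 * d)

/-- The normalizing factor `M`, with `A` in place of the product of `K`, `c₀` and the universal
constant. -/
noncomputable def normalizer (n m : ℕ) (d N A : ℝ) : ℝ :=
  √(N / m) * A ^ ((m : ℝ) / decayExponent n m) *
    (3 * d ^ 2 * Real.log (Real.exp 1 * d)) ^ (((n : ℝ) - 3 / 2) / decayExponent n m) *
    (n : ℝ) ^ (1 / (2 * (m : ℝ) - 2 * n + 3)) * max (d ^ 6) (n / d ^ 2)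

variable {n m : ℕ} {d N A : ℝ}

theorem half_le_decayExponent (hnm : n ≤ m + 1) : 1 / 2 ≤ decayExponent n m := by
  have hnmR : (n : ℝ) ≤ m + 1 := by exact_mod_cast hnm
  rw [decayExponent]
  linarith

theorem decayExponent_pos (hnm : n ≤ m + 1) : 0 < decayExponent n m :=
  one_half_pos.trans_le (half_le_decayExponent hnm)

theorem rpow_decayExponent_mul_rpow (n m : ℕ) {x : ℝ} (hx : 0 < x) :
    x ^ decayExponent n m * x ^ ((n : ℝ) - 3 / 2) = x ^ m := by
  rw [← Real.rpow_add hx, ← Real.rpow_natCast, decayExponent]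
  ring_nf

theorem pow_mul_div_rpow (n m : ℕ) {α γ : ℝ} (hα : 0 < α) (hγ : 0 ≤ γ) :
    α ^ m * (γ / α) ^ ((n : ℝ) - 3 / 2)
      = α ^ decayExponent n m * γ ^ ((n : ℝ) - 3 / 2) := by
  rw [← rpow_decayExponent_mul_rpow n m hα, Real.div_rpow hγ hα.le, mul_assoc,
    mul_div_cancel₀ _ (Real.rpow_pos_of_pos hα _).ne']

theorem sqrt_rpow_eq_mul_div_rpow {a b : ℝ} (ha : 0 ≤ a) (hb : 0 < b) (p : ℝ) :
    √a ^ p = √b ^ p * (a / b) ^ (p / 2) := by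
  have hsqrt : √(a / b) ^ p = (a / b) ^ (p / 2) := by
    rw [Real.sqrt_eq_rpow, ← Real.rpow_mul (by positivity)]
    ring_nf
  rw [← hsqrt, ← Real.mul_rpow (by positivity) (by positivity), ← Real.sqrt_mul hb.le,
    mul_div_cancel₀ _ hb.ne']

theorem one_le_log_exp_one_mul (hd : 1 ≤ d) : 1 ≤ Real.log (Real.exp 1 * d) := by
  rw [Real.log_mul (Real.exp_pos 1).ne' (by linarith), Real.log_exp]
  linarith [Real.log_nonneg hd]

theorem le_logDim (m : ℕ) (hd : 1 ≤ d) : (m : ℝ) ≤ logDim m d :=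
  le_mul_of_one_le_right (Nat.cast_nonneg m) (one_le_log_exp_one_mul hd)

theorem sqrt_div_le_normalizer (hn : 2 ≤ n) (hnm : n ≤ m + 1) (hd : 1 ≤ d) (hA : 1 ≤ A) :
    √(N / m) ≤ normalizer n m d N A := by
  have hnR : (2 : ℝ) ≤ n := by exact_mod_cast hn
  have hnmR : (n : ℝ) ≤ m + 1 := by exact_mod_cast hnm
  have hr := decayExponent_pos hnm
  have hL := one_le_log_exp_one_mul hd
  have hd2 : 1 ≤ d ^ 2 := one_le_pow₀ hd
  have hA1 : 1 ≤ A ^ ((m : ℝ) / decayExponent n m) := Real.one_le_rpow hA (by positivity)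
  have hL1 : 1 ≤ (3 * d ^ 2 * Real.log (Real.exp 1 * d)) ^
      (((n : ℝ) - 3 / 2) / decayExponent n m) :=
    Real.one_le_rpow (by nlinarith) (div_nonneg (by linarith) hr.le)
  have hn1 : 1 ≤ (n : ℝ) ^ (1 / (2 * (m : ℝ) - 2 * n + 3)) :=
    Real.one_le_rpow (by linarith) (div_nonneg zero_le_one (by linarith))
  have hmax : 1 ≤ max (d ^ 6) (n / d ^ 2) := le_max_of_le_left (one_le_pow₀ hd)
  rw [normalizer, mul_assoc, mul_assoc, mul_assoc]
  exact le_mul_of_one_le_right (Real.sqrt_nonneg _) <| one_le_mul_of_one_le_of_one_le hA1 <|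
    one_le_mul_of_one_le_of_one_le hL1 <| one_le_mul_of_one_le_of_one_le hn1 hmax

theorem normalizer_rpow (hnm : n ≤ m + 1) (hd : 1 ≤ d) (hN : 0 ≤ N) (hA : 0 ≤ A) :
    normalizer n m d N A ^ decayExponent n m =
      √N ^ decayExponent n m / √m ^ decayExponent n m * A ^ m *
        (3 * d ^ 2 * Real.log (Real.exp 1 * d)) ^ ((n : ℝ) - 3 / 2) * (n : ℝ) ^ (1 / 2 : ℝ) *
        max (d ^ 6) (n / d ^ 2) ^ decayExponent n m := by
  have hr := (decayExponent_pos hnm).ne'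
  have hL := zero_le_one.trans (one_le_log_exp_one_mul hd)
  have hmax : 0 ≤ max (d ^ 6) (n / d ^ 2) := le_max_of_le_left (by positivity)
  have hexponent : 1 / (2 * (m : ℝ) - 2 * n + 3) * decayExponent n m = 1 / 2 := by
    rw [show 2 * (m : ℝ) - 2 * n + 3 = 2 * decayExponent n m by rw [decayExponent]; ring]
    field_simp
  rw [normalizer, Real.mul_rpow (by positivity) hmax, Real.mul_rpow (by positivity) (by positivity),
    Real.mul_rpow (by positivity) (by positivity), Real.mul_rpow (by positivity) (by positivity),
    ← Real.rpow_mul hA, ← Real.rpow_mul (by positivity), ← Real.rpow_mul (by positivity),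
    div_mul_cancel₀ _ hr, div_mul_cancel₀ _ hr, hexponent, Real.rpow_natCast, Real.sqrt_div hN,
    Real.div_rpow (by positivity) (by positivity)]

theorem forty_mul_sq_pow_le (hnm : n ≤ m + 1) (hm : 1 ≤ m) (hd : 1 ≤ d) :
    (40 * d ^ 2) ^ n ≤
      1600 ^ m * ((d ^ 2) ^ ((n : ℝ) - 3 / 2) * (d ^ 6) ^ decayExponent n m) := by
  have hforty : (40 : ℝ) ^ n ≤ 1600 ^ m := by
    rw [show (1600 : ℝ) = 40 ^ 2 by norm_num, ← pow_mul]
    exact pow_le_pow_right₀ (by norm_num) (by lia)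
  have hd_pow : (d ^ 2) ^ n ≤ (d ^ 2) ^ ((n : ℝ) - 3 / 2) * (d ^ 6) ^ decayExponent n m :=
    calc (d ^ 2) ^ n = (d ^ 2) ^ ((n : ℝ) - 3 / 2) * (d ^ 2) ^ (3 / 2 : ℝ) := by
          rw [← Real.rpow_add (by positivity), sub_add_cancel, Real.rpow_natCast]
      _ ≤ (d ^ 2) ^ ((n : ℝ) - 3 / 2) * (d ^ 2) ^ (3 * decayExponent n m) := by
          gcongr
          · exact one_le_pow₀ hd
          · linarith [half_le_decayExponent hnm]
      _ = (d ^ 2) ^ ((n : ℝ) - 3 / 2) * (d ^ 6) ^ decayExponent n m := by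
          rw [Real.rpow_mul (by positivity), Real.rpow_ofNat, ← pow_mul]
  rw [mul_pow]
  gcongr

theorem twelve_rpow_mul_rpow_le (hn : 2 ≤ n) :
    (12 : ℝ) ^ decayExponent n m * 25 ^ ((n : ℝ) - 3 / 2) ≤ 12 ^ m * 3 ^ ((n : ℝ) - 3 / 2) := by
  have hnR : (2 : ℝ) ≤ n := by exact_mod_cast hn
  rw [← rpow_decayExponent_mul_rpow n m (by norm_num : (0 : ℝ) < 12), mul_assoc,
    ← Real.mul_rpow (by norm_num) (by norm_num)]
  gcongr <;> linarith

theorem four_mul_exp_one_mul_pow_mul_le (m : ℕ) {K c₀ : ℝ} (hK : 0 ≤ K) (hc₀ : 0 ≤ c₀) :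
    (4 * Real.exp 1 * c₀) ^ m * 1600 ^ m * 12 ^ m * K ^ m ≤ (K * c₀ * 10 ^ 6) ^ m := by
  rw [← mul_pow, ← mul_pow, ← mul_pow]
  refine pow_le_pow_left₀ (by positivity) ?_ m
  calc 4 * Real.exp 1 * c₀ * 1600 * 12 * K = K * c₀ * (4 * Real.exp 1 * 1600 * 12) := by ring
    _ ≤ K * c₀ * 10 ^ 6 := by
        gcongr
        linarith [Real.exp_one_lt_d9]

theorem const_le_normalizer_rpow (hn : 2 ≤ n) (hnm : n ≤ m + 1) (hd : 1 ≤ d) (hN : 0 ≤ N)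
    {K c₀ : ℝ} (hK : 0 ≤ K) (hc₀ : 0 ≤ c₀) :
    (4 * Real.exp 1 * c₀ / √m) ^ m * (40 * d ^ 2) ^ n * 12 ^ decayExponent n m *
        25 ^ ((n : ℝ) - 3 / 2) * K ^ m * √N ^ decayExponent n m *
        √(logDim m d) ^ ((n : ℝ) - 3 / 2)
      ≤ normalizer n m d N (K * c₀ * 10 ^ 6) ^ decayExponent n m := by
  have hnR : (2 : ℝ) ≤ n := by exact_mod_cast hn
  have hm : 1 ≤ m := by lia
  have hsqrt : 0 < √(m : ℝ) := Real.sqrt_pos.2 (by exact_mod_cast hm)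
  have hL := one_le_log_exp_one_mul hd
  have hr := decayExponent_pos hnm
  have hn1 : 1 ≤ (n : ℝ) ^ (1 / 2 : ℝ) := Real.one_le_rpow (by linarith) (by norm_num)
  have hforty := forty_mul_sq_pow_le hnm hm hd
  have htwelve := twelve_rpow_mul_rpow_le (m := m) hn
  have hconst := four_mul_exp_one_mul_pow_mul_le m hK hc₀
  rw [normalizer_rpow hnm hd hN (by positivity), logDim, Real.sqrt_mul (Nat.cast_nonneg m),
    Real.mul_rpow (by positivity) (by positivity), div_pow, ← rpow_decayExponent_mul_rpow n m hsqrt,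
    Real.mul_rpow (by positivity) (by positivity), Real.mul_rpow (by norm_num) (by positivity)]
  set r := decayExponent n m
  set e := (n : ℝ) - 3 / 2
  set L := Real.log (Real.exp 1 * d)
  have he : 0 ≤ e := by simp only [e]; linarith
  have hsqrtL : √L ^ e ≤ L ^ e := by
    gcongr
    exact Real.sqrt_le_iff.2 ⟨by positivity, le_self_pow₀ hL two_ne_zero⟩
  have hmax : (d ^ 6) ^ r ≤ max (d ^ 6) (n / d ^ 2) ^ r := by
    gcongr
    exact le_max_left _ _
  calc (4 * Real.exp 1 * c₀) ^ m / (√m ^ r * √m ^ e) * (40 * d ^ 2) ^ n * 12 ^ r * 25 ^ e * K ^ m *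
        √N ^ r * (√m ^ e * √L ^ e)
      = √N ^ r / √m ^ r * ((4 * Real.exp 1 * c₀) ^ m * K ^ m) * (40 * d ^ 2) ^ n *
          (12 ^ r * 25 ^ e) * √L ^ e * 1 := by field_simp
    _ ≤ √N ^ r / √m ^ r * ((4 * Real.exp 1 * c₀) ^ m * K ^ m) *
          (1600 ^ m * ((d ^ 2) ^ e * max (d ^ 6) (n / d ^ 2) ^ r)) * (12 ^ m * 3 ^ e) * L ^ e *
          (n : ℝ) ^ (1 / 2 : ℝ) := by
        gcongr
        exact hforty.trans (by gcongr)
    _ = √N ^ r / √m ^ r * ((4 * Real.exp 1 * c₀) ^ m * 1600 ^ m * 12 ^ m * K ^ m) *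
          (3 ^ e * (d ^ 2) ^ e * L ^ e) * (n : ℝ) ^ (1 / 2 : ℝ) *
          max (d ^ 6) (n / d ^ 2) ^ r := by ring
    _ ≤ _ := by gcongr

theorem smallBall_bound_le (hn : 2 ≤ n) (hnm : n ≤ m + 1) (hd : 1 ≤ d) (hN : 0 < N) {K c₀ : ℝ}
    (hK : 0 < K) (hc₀ : 0 ≤ c₀) {M t a b α γ : ℝ} (hM0 : 0 < M)
    (hM : M = normalizer n m d N (K * c₀ * 10 ^ 6)) (ht : 0 < t) (ha : 0 < a) (hb : 0 ≤ b)
    (hα : α = 12 * K * √a / (t * M)) (hγ : γ = 25 * K * √b) :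
    (4 * Real.exp 1 * c₀ * α / √m) ^ m * (40 * d ^ 2) ^ n * (γ / α) ^ ((n : ℝ) - 3 / 2)
      ≤ 1 / t ^ decayExponent n m * ((a / N) ^ (decayExponent n m / 2) *
        (b / logDim m d) ^ (((n : ℝ) - 3 / 2) / 2)) := by
  have hconst := const_le_normalizer_rpow hn hnm hd hN.le hK.le hc₀
  rw [← hM] at hconst
  have hl : 0 < logDim m d :=
    (Nat.cast_pos.2 (by lia : 0 < m)).trans_le (le_logDim m hd)
  have hα0 : 0 < α := by rw [hα]; positivity
  have hγ0 : 0 ≤ γ := by rw [hγ]; positivity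
  have hswap := pow_mul_div_rpow n m hα0 hγ0
  have hKm := rpow_decayExponent_mul_rpow n m hK
  set r := decayExponent n m
  set e := (n : ℝ) - 3 / 2
  have hαr : α ^ r = 12 ^ r * K ^ r * (√N ^ r * (a / N) ^ (r / 2)) / (t ^ r * M ^ r) := by
    rw [hα, Real.div_rpow (by positivity) (by positivity),
      Real.mul_rpow (by positivity) (by positivity), Real.mul_rpow (by positivity) (by positivity),
      Real.mul_rpow (by positivity) (by positivity), sqrt_rpow_eq_mul_div_rpow ha.le hN]
  have hγe : γ ^ e = 25 ^ e * K ^ e * (√(logDim m d) ^ e * (b / logDim m d) ^ (e / 2)) := by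
    rw [hγ, Real.mul_rpow (by positivity) (by positivity),
      Real.mul_rpow (by positivity) (by positivity), sqrt_rpow_eq_mul_div_rpow hb hl]
  calc (4 * Real.exp 1 * c₀ * α / √m) ^ m * (40 * d ^ 2) ^ n * (γ / α) ^ e
      = (4 * Real.exp 1 * c₀ / √m) ^ m * (40 * d ^ 2) ^ n * (α ^ m * (γ / α) ^ e) := by ring
    _ = (4 * Real.exp 1 * c₀ / √m) ^ m * (40 * d ^ 2) ^ n * 12 ^ r * 25 ^ e * K ^ m * √N ^ r *
          √(logDim m d) ^ e / M ^ r *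
          (1 / t ^ r * ((a / N) ^ (r / 2) * (b / logDim m d) ^ (e / 2))) := by
        rw [hswap, hαr, hγe, ← hKm]
        field_simp
    _ ≤ 1 * (1 / t ^ r * ((a / N) ^ (r / 2) * (b / logDim m d) ^ (e / 2))) := by
        gcongr
        exact (div_le_one (by positivity)).2 hconst
    _ = _ := one_mul _

theorem twelve_pow_le_exp (N : ℕ) : (12 : ℝ) ^ N ≤ Real.exp (3 * N) := by
  rw [mul_comm, Real.exp_nat_mul]
  gcongr
  calc (12 : ℝ) ≤ 2.7 ^ 3 := by norm_num
    _ ≤ Real.exp 1 ^ 3 := by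
        gcongr
        linarith [Real.exp_one_gt_d9]
    _ = Real.exp 3 := by
        rw [← Real.exp_nat_mul]
        norm_num

theorem three_pow_mul_forty_mul_sq_pow_le_exp (hnm : n ≤ m + 1) (hm : 1 ≤ m) (hd : 1 ≤ d) :
    3 ^ m * (40 * d ^ 2) ^ n ≤ Real.exp (9 * logDim m d) := by
  have hforty : (40 * d ^ 2) ^ n ≤ (1600 * d ^ 4) ^ m := by
    rw [show 1600 * d ^ 4 = (40 * d ^ 2) ^ 2 by ring, ← pow_mul]
    exact pow_le_pow_right₀ (by linarith [one_le_pow₀ (n := 2) hd]) (by lia)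
  have hexp : (4800 : ℝ) ≤ Real.exp 1 ^ 9 :=
    calc (4800 : ℝ) ≤ 2.7 ^ 9 := by norm_num
      _ ≤ Real.exp 1 ^ 9 := by
          gcongr
          linarith [Real.exp_one_gt_d9]
  calc 3 ^ m * (40 * d ^ 2) ^ n ≤ 3 ^ m * (1600 * d ^ 4) ^ m := by gcongr
    _ = (4800 * d ^ 4) ^ m := by
        rw [← mul_pow]
        ring
    _ ≤ (Real.exp 1 ^ 9 * d ^ 9) ^ m := by
        gcongr
        norm_num
    _ = Real.exp (9 * logDim m d) := by
        have hpos : 0 < Real.exp 1 * d := by positivity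
        rw [← mul_pow, ← pow_mul, ← Real.exp_log (pow_pos hpos (9 * m)), Real.log_pow, logDim]
        push_cast
        ring_nf

theorem exp_neg_mul_log {t : ℝ} (ht : 0 < t) (r : ℝ) :
    Real.exp (-(r * Real.log t)) = 1 / t ^ r := by
  rw [Real.exp_neg, Real.rpow_def_of_pos ht, one_div, mul_comm]

end Constants

section TailFactor

/-- The factor by which the tail of the condition number exceeds the power law `3 / t ^ r`, in terms
of `q = r log t` and of the thresholds `N` and `l` beyond which the two sub-Gaussian truncations
have to grow with `t`. -/
noncomputable def tailFactor (n m : ℕ) (N l q : ℝ) : ℝ :=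
  (max N q / N) ^ (decayExponent n m / 2) * (max l q / l) ^ (((n : ℝ) - 3 / 2) / 2)

variable {n m : ℕ} {N l q : ℝ}

theorem one_le_tailFactor (hn : 2 ≤ n) (hnm : n ≤ m + 1) (hN : 0 < N) (hl : 0 < l) :
    1 ≤ tailFactor n m N l q := by
  have hnR : (2 : ℝ) ≤ n := by exact_mod_cast hn
  exact one_le_mul_of_one_le_of_one_le
    (Real.one_le_rpow ((one_le_div hN).2 (le_max_left _ _)) (half_pos (decayExponent_pos hnm)).le)
    (Real.one_le_rpow ((one_le_div hl).2 (le_max_left _ _)) (by linarith))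

theorem tailFactor_eq_one (hN : 0 < N) (hl : 0 < l) (hqN : q ≤ N) (hql : q ≤ l) :
    tailFactor n m N l q = 1 := by
  rw [tailFactor, max_eq_left hqN, max_eq_left hql, div_self hN.ne', div_self hl.ne',
    Real.one_rpow, Real.one_rpow, one_mul]

theorem tailFactor_eq_rpow (hN : 0 < N) (hqN : q ≤ N) (hlq : l ≤ q) :
    tailFactor n m N l q = (q / l) ^ (((n : ℝ) - 3 / 2) / 2) := by
  rw [tailFactor, max_eq_left hqN, max_eq_right hlq, div_self hN.ne', Real.one_rpow, one_mul]

theorem rpow_half_natCast_eq_mul (n m : ℕ) {x : ℝ} (hx : 0 < x) :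
    x ^ ((m : ℝ) / 2) = x ^ (decayExponent n m / 2) * x ^ (((n : ℝ) - 3 / 2) / 2) := by
  rw [← Real.rpow_add hx, decayExponent]
  ring_nf

theorem tailFactor_eq_rpow_mul_rpow (hN : 0 < N) (hl : 0 < l) (hNq : N ≤ q) (hlq : l ≤ q) :
    tailFactor n m N l q =
      (q / N) ^ ((m : ℝ) / 2) * (N / l) ^ (((n : ℝ) - 3 / 2) / 2) := by
  have hqN : 0 < q / N := div_pos (hN.trans_le hNq) hN
  rw [tailFactor, max_eq_right hNq, max_eq_right hlq, rpow_half_natCast_eq_mul n m hqN,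
    ← div_mul_div_cancel₀ hN.ne' (a := q) (c := l), Real.mul_rpow hqN.le (by positivity), mul_assoc]

theorem tailFactor_le_rpow (hn : 2 ≤ n) (hN : 0 < N) (hNl : N ≤ l) (hNq : N ≤ q) :
    tailFactor n m N l q ≤ (q / N) ^ ((m : ℝ) / 2) := by
  have hnR : (2 : ℝ) ≤ n := by exact_mod_cast hn
  have hl := hN.trans_le hNl
  have hq := hN.trans_le hNq
  have hmax : max l q / l ≤ q / N := by
    rw [← max_div_div_right hl.le, div_self hl.ne']
    exact max_le ((one_le_div hN).2 hNq) (by gcongr)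
  rw [tailFactor, max_eq_right hNq, rpow_half_natCast_eq_mul n m (div_pos hq hN)]
  gcongr
  linarith

end TailFactor

section Tail

theorem max_le_div_mul_max {m N l q : ℝ} (hm : 0 < m) (hN : m ≤ N) (hl : m ≤ l) (hq : 0 ≤ q) :
    max N q ≤ N / m * max l q := by
  have hN0 := hm.trans_le hN
  refine max_le ?_ ?_
  · calc N = N / m * m := (div_mul_cancel₀ N hm.ne').symm
      _ ≤ N / m * max l q := by
          gcongr
          exact hl.trans (le_max_left _ _)
  · calc q ≤ N / m * q := le_mul_of_one_le_left hq ((one_le_div hm).2 hN)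
      _ ≤ N / m * max l q := by
          gcongr
          exact le_max_right _ _

theorem exp_neg_four_mul_mul_twelve_pow_le {N : ℕ} {a q : ℝ} (hN : N ≤ a) (hq : q ≤ a) :
    Real.exp (-(4 * a)) * 12 ^ N ≤ Real.exp (-q) :=
  calc Real.exp (-(4 * a)) * 12 ^ N ≤ Real.exp (-(4 * a)) * Real.exp (3 * N) := by
        gcongr
        exact twelve_pow_le_exp N
    _ = Real.exp (-(4 * a) + 3 * N) := (Real.exp_add _ _).symm
    _ ≤ Real.exp (-q) := Real.exp_le_exp.2 (by linarith)

theorem exp_neg_ten_mul_mul_pow_le {n m : ℕ} (hnm : n ≤ m + 1) (hm : 1 ≤ m) {d b q : ℝ}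
    (hd : 1 ≤ d) (hb : logDim m d ≤ b) (hq : q ≤ b) :
    Real.exp (-(10 * b)) * 3 ^ m * (40 * d ^ 2) ^ n ≤ Real.exp (-q) :=
  calc Real.exp (-(10 * b)) * 3 ^ m * (40 * d ^ 2) ^ n
      = Real.exp (-(10 * b)) * (3 ^ m * (40 * d ^ 2) ^ n) := mul_assoc _ _ _
    _ ≤ Real.exp (-(10 * b)) * Real.exp (9 * logDim m d) := by
        gcongr
        exact three_pow_mul_forty_mul_sq_pow_le_exp hnm hm hd
    _ = Real.exp (-(10 * b) + 9 * logDim m d) := (Real.exp_add _ _).symm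
    _ ≤ Real.exp (-q) := Real.exp_le_exp.2 (by linarith)

theorem le_mul_log_of_exp_div_le {A r t : ℝ} (hr : 0 < r) (h : Real.exp (A / r) ≤ t) :
    A ≤ r * Real.log t :=
  (div_le_iff₀' hr).1 ((Real.le_log_iff_exp_le ((Real.exp_pos _).trans_le h)).2 h)

theorem mul_log_le_of_le_exp_div {A r t : ℝ} (hr : 0 < r) (ht : 0 < t)
    (h : t ≤ Real.exp (A / r)) : r * Real.log t ≤ A :=
  (le_div_iff₀' hr).1 ((Real.log_le_iff_le_exp ht).2 h)

variable {n m : ℕ} {deg : Fin m → ℕ} {Ω : Type*} [MeasurableSpace Ω] {μ : Measure Ω}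
  [IsProbabilityMeasure μ] {X : ∀ j : Fin m, Ω → EuclideanSpace ℝ (WExp n (deg j))} {K c₀ : ℝ}
  {d : ℕ}

theorem measureReal_condGlobal_le_add (hn : 2 ≤ n) (hm : 1 ≤ m) (hdeg : ∀ j, 1 ≤ deg j)
    (hd : ∀ j, deg j ≤ d) (hX : ∀ j, Measurable (X j)) (hind : iIndepFun X μ) (hK : 0 < K)
    (hc₀ : 0 ≤ c₀) (hsg : ∀ j, SubGaussianVec μ (X j) K) (hsb : ∀ j, SmallBallVec μ (X j) c₀)
    {α γ v s : ℝ} (hα : 0 < α) (hαγ : α ≤ γ) (hv : 0 ≤ v) (hs : 0 < s)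
    (hαs : 2 * (√(8 * v) * K) ≤ α * s) :
    μ.real {ω | ENNReal.ofReal s ≤ condGlobal deg fun j => weylPoly (X j ω)}
      ≤ Real.exp (-v) * 12 ^ coeffDim n deg
        + Real.exp (-(γ ^ 2 / (8 * K ^ 2))) * 3 ^ m * (40 * d ^ 2) ^ n
        + (4 * Real.exp 1 * c₀ * α / √m) ^ m * (40 * d ^ 2) ^ n
          * (γ / α) ^ ((n : ℝ) - 3 / 2) := by
  have hd1 : 1 ≤ d := (hdeg ⟨0, hm⟩).trans (hd _)
  refine le_trans ?_ (add_le_add (add_le_add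
    (measureReal_le_weylNormSys_le (by lia) hX hind hK hsg hv)
    (measureReal_exists_le_norm_evalSys_le hd1 hd hX hind hK hsg (hα.le.trans hαγ)))
    (measureReal_exists_norm_evalSys_norm_dirDeriv_le_le hn hm hd1 hd hX hind hc₀ hsb hα hαγ))
  refine le_trans (measureReal_mono fun ω hω => ?_) ((measureReal_union_le _ _).trans
    (add_le_add_left (measureReal_union_le _ _) _))
  rcases le_or_gt (√(8 * v) * K) (weylNormSys deg fun j => weylPoly (X j ω)) with hweyl | hweyl
  · exact Or.inl (Or.inl hweyl)
  by_cases hsup : ∃ x, ‖x‖ = 1 ∧ γ ≤ ‖evalSys (fun j => weylPoly (X j ω)) x‖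
  · exact Or.inl (Or.inr hsup)
  · exact Or.inr ⟨fun x hx => le_of_not_ge fun hle => hsup ⟨x, hx, hle⟩,
      exists_norm_evalSys_norm_dirDeriv_le_of_le_condGlobal hn hdeg hd hs (by linarith) hω⟩

theorem one_le_mul_mul_of_subGaussianVec_of_smallBallVec (hn : 2 ≤ n) (hm : 1 ≤ m) (hK : 0 < K)
    (hsg : ∀ j, SubGaussianVec μ (X j) K) (hsb : ∀ j, SmallBallVec μ (X j) c₀) :
    1 ≤ K * c₀ * 10 ^ 6 := by
  let j₀ : Fin m := ⟨0, hm⟩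
  have : Nonempty (WExp n (deg j₀)) := by
    rw [← Fintype.card_pos_iff, card_wExp]
    exact Nat.choose_pos (by lia)
  linarith [one_fourth_le_mul_of_subGaussianVec_of_smallBallVec hK (hsg j₀) (hsb j₀)]

theorem div_mul_le_mul_sqrt {N a b M t : ℝ} {m : ℕ} (hN : 0 ≤ N) (hK : 0 ≤ K) (hM0 : 0 < M)
    (hM : √(N / m) ≤ M) (ht : 1 ≤ t) (hab : a ≤ N / m * b) :
    12 * K * √a / (t * M) ≤ 25 * K * √b := by
  have hsqrt : √a ≤ t * M * √b :=
    calc √a ≤ √(N / m * b) := Real.sqrt_le_sqrt hab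
      _ = √(N / m) * √b := Real.sqrt_mul (by positivity) _
      _ ≤ t * M * √b := by
          gcongr
          exact hM.trans (le_mul_of_one_le_left hM0.le ht)
  rw [div_le_iff₀ (by positivity)]
  calc 12 * K * √a ≤ 25 * K * (t * M * √b) := by
        gcongr
        norm_num
    _ = 25 * K * √b * (t * M) := by ring

theorem two_mul_sqrt_mul_le {a : ℝ} (ha : 0 ≤ a) (hK : 0 ≤ K) :
    2 * (√(8 * (4 * a)) * K) ≤ 12 * K * √a := by
  have hsqrt : √(8 * (4 * a)) ≤ 6 * √a := by
    rw [Real.sqrt_le_left (by positivity), mul_pow, Real.sq_sqrt ha]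
    linarith
  calc 2 * (√(8 * (4 * a)) * K) ≤ 2 * (6 * √a * K) := by gcongr
    _ = 12 * K * √a := by ring

/-- The truncation levels are `√(32 a) K` for the Weyl norm and `25 K √b` for the supremum. -/
theorem measureReal_condGlobal_le_of_le (hn : 2 ≤ n) (hnm : n ≤ m + 1) (hdeg : ∀ j, 1 ≤ deg j)
    (hd : ∀ j, deg j ≤ d) (hX : ∀ j, Measurable (X j)) (hind : iIndepFun X μ) (hK : 0 < K)
    (hc₀ : 0 ≤ c₀) (hsg : ∀ j, SubGaussianVec μ (X j) K) (hsb : ∀ j, SmallBallVec μ (X j) c₀)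
    {t a b : ℝ} (ht : 1 ≤ t) (hNa : coeffDim n deg ≤ a) (hta : decayExponent n m * Real.log t ≤ a)
    (hlb : logDim m d ≤ b) (htb : decayExponent n m * Real.log t ≤ b)
    (hab : a ≤ coeffDim n deg / m * b) :
    μ.real {ω | ENNReal.ofReal (t * normalizer n m d (coeffDim n deg) (K * c₀ * 10 ^ 6)) ≤
        condGlobal deg fun j => weylPoly (X j ω)}
      ≤ 1 / t ^ decayExponent n m + 1 / t ^ decayExponent n m + 1 / t ^ decayExponent n m *
        ((a / coeffDim n deg) ^ (decayExponent n m / 2) *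
          (b / logDim m d) ^ (((n : ℝ) - 3 / 2) / 2)) := by
  have hm : 1 ≤ m := by lia
  have hm0 : (0 : ℝ) < m := by exact_mod_cast hm
  have hd1 : (1 : ℝ) ≤ d := by exact_mod_cast (hdeg ⟨0, hm⟩).trans (hd _)
  have hN0 : (0 : ℝ) < coeffDim n deg := by
    exact_mod_cast hm.trans (le_coeffDim (by lia) deg)
  have ht0 := zero_lt_one.trans_le ht
  have ha0 := hN0.trans_le hNa
  have hb0 := (hm0.trans_le (le_logDim m hd1)).trans_le hlb
  have hsqrtM := sqrt_div_le_normalizer (N := coeffDim n deg) hn hnm hd1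
    (one_le_mul_mul_of_subGaussianVec_of_smallBallVec hn hm hK hsg hsb)
  have hM0 := (Real.sqrt_pos.2 (div_pos hN0 hm0)).trans_le hsqrtM
  refine (measureReal_condGlobal_le_add hn hm hdeg hd hX hind hK hc₀ hsg hsb (by positivity)
    (div_mul_le_mul_sqrt hN0.le hK.le hM0 hsqrtM ht hab) (v := 4 * a) (by positivity)
    (by positivity) ?_).trans (add_le_add (add_le_add ?_ ?_) ?_)
  · rw [div_mul_cancel₀ _ (by positivity)]
    exact two_mul_sqrt_mul_le ha0.le hK.le
  · rw [← exp_neg_mul_log ht0]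
    exact exp_neg_four_mul_mul_twelve_pow_le hNa hta
  · have hsup : 10 * b ≤ (25 * K * √b) ^ 2 / (8 * K ^ 2) := by
      rw [mul_pow, Real.sq_sqrt hb0.le, le_div_iff₀ (by positivity)]
      nlinarith [mul_pos (pow_pos hK 2) hb0]
    rw [← exp_neg_mul_log ht0]
    refine le_trans ?_ (exp_neg_ten_mul_mul_pow_le hnm hm hd1 hlb htb)
    gcongr
  · exact smallBall_bound_le hn hnm hd1 hN0 hK hc₀ hM0 rfl ht0 ha0 hb0.le rfl rfl

theorem measureReal_condGlobal_le (hn : 2 ≤ n) (hnm : n ≤ m + 1) (hdeg : ∀ j, 1 ≤ deg j)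
    (hd : ∀ j, deg j ≤ d) (hX : ∀ j, Measurable (X j)) (hind : iIndepFun X μ) (hK : 0 < K)
    (hc₀ : 0 ≤ c₀) (hsg : ∀ j, SubGaussianVec μ (X j) K) (hsb : ∀ j, SmallBallVec μ (X j) c₀)
    {t : ℝ} (ht : 1 ≤ t) :
    μ.real {ω | ENNReal.ofReal (t * normalizer n m d (coeffDim n deg) (K * c₀ * 10 ^ 6)) ≤
        condGlobal deg fun j => weylPoly (X j ω)}
      ≤ 3 / t ^ decayExponent n m *
        tailFactor n m (coeffDim n deg) (logDim m d) (decayExponent n m * Real.log t) := by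
  have hm0 : (0 : ℝ) < m := by exact_mod_cast (by lia : 0 < m)
  have hd1 : (1 : ℝ) ≤ d := by exact_mod_cast (hdeg ⟨0, by lia⟩).trans (hd _)
  have hmN : (m : ℝ) ≤ coeffDim n deg := by exact_mod_cast le_coeffDim (by lia) deg
  have hml := le_logDim m hd1
  have hq : 0 ≤ decayExponent n m * Real.log t :=
    mul_nonneg (decayExponent_pos hnm).le (Real.log_nonneg ht)
  have hone : 1 ≤ tailFactor n m (coeffDim n deg) (logDim m d) (decayExponent n m * Real.log t) :=
    one_le_tailFactor hn hnm (hm0.trans_le hmN) (hm0.trans_le hml)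
  refine (measureReal_condGlobal_le_of_le hn hnm hdeg hd hX hind hK hc₀ hsg hsb ht
    (le_max_left _ _) (le_max_right _ _) (le_max_left _ _) (le_max_right _ _)
    (max_le_div_mul_max hm0 hmN hml hq)).trans ?_
  rw [← tailFactor]
  calc 1 / t ^ decayExponent n m + 1 / t ^ decayExponent n m + 1 / t ^ decayExponent n m *
        tailFactor n m (coeffDim n deg) (logDim m d) (decayExponent n m * Real.log t)
      = 1 / t ^ decayExponent n m * (2 +
          tailFactor n m (coeffDim n deg) (logDim m d) (decayExponent n m * Real.log t)) := by ring
    _ ≤ 1 / t ^ decayExponent n m * (3 *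
          tailFactor n m (coeffDim n deg) (logDim m d) (decayExponent n m * Real.log t)) := by
        gcongr
        linarith
    _ = _ := by ring

end Tail

theorem theorem3p6 :
    ∃ C : ℝ, 0 < C ∧
      ∀ (n m : ℕ), 2 ≤ n → n ≤ m + 1 →
      ∀ (deg : Fin m → ℕ), (∀ j, 1 ≤ deg j) →
      ∀ (Ω : Type*) [MeasurableSpace Ω] (μ : Measure Ω) [IsProbabilityMeasure μ]
        (X : ∀ j : Fin m, Ω → EuclideanSpace ℝ (WExp n (deg j))),
        (∀ j, Measurable (X j)) → iIndepFun X μ →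
      ∀ (K c₀ : ℝ), 0 < K → 0 < c₀ →
        (∀ j, SubGaussianVec μ (X j) K) → (∀ j, SmallBallVec μ (X j) c₀) →
      let d : ℝ := ((Finset.univ.sup deg : ℕ) : ℝ)
      let N : ℝ := ((∑ j, (n + deg j - 1).choose (deg j) : ℕ) : ℝ)
      let r : ℝ := (m : ℝ) - n + 3 / 2
      let l : ℝ := m * Real.log (Real.exp 1 * d)
      let M : ℝ := Real.sqrt (N / m) * (K * c₀ * C) ^ ((m : ℝ) / r) *
        (3 * d ^ 2 * Real.log (Real.exp 1 * d)) ^ (((n : ℝ) - 3 / 2) / r) *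
        (n : ℝ) ^ (1 / (2 * (m : ℝ) - 2 * n + 3)) * max (d ^ 6) (n / d ^ 2)
      let prob : ℝ → ℝ := fun s =>
        μ.real {ω | ENNReal.ofReal s ≤ condGlobal deg (fun j => weylPoly (X j ω))}
      (l ≤ N → ∀ t : ℝ,
        (1 ≤ t → t ≤ Real.exp (l / r) → prob (t * M) ≤ 3 / t ^ r) ∧
        (Real.exp (l / r) ≤ t → t ≤ Real.exp (N / r) →
          prob (t * M) ≤ 3 / t ^ r * (r * Real.log t / l) ^ (((n : ℝ) - 3 / 2) / 2)) ∧
        (Real.exp (N / r) ≤ t →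
          prob (t * M) ≤ 3 / t ^ r * (r * Real.log t / N) ^ ((m : ℝ) / 2) *
            (N / l) ^ (((n : ℝ) - 3 / 2) / 2))) ∧
      (N ≤ l → ∀ t : ℝ,
        (1 ≤ t → t ≤ Real.exp (N / r) → prob (t * M) ≤ 3 / t ^ r) ∧
        (Real.exp (N / r) ≤ t →
          prob (t * M) ≤ 3 / t ^ r * (r * Real.log t / N) ^ ((m : ℝ) / 2))) := by
  refine ⟨10 ^ 6, by norm_num, ?_⟩
  intro n m hn hnm deg hdeg Ω _ μ _ X hX hind K c₀ hK hc₀ hsg hsb d N r l M prob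
  have hdle : ∀ j, deg j ≤ Finset.univ.sup deg := fun j => Finset.le_sup (Finset.mem_univ j)
  have hm0 : (0 : ℝ) < m := Nat.cast_pos.2 (by lia)
  have hd : 1 ≤ d := Nat.one_le_cast.2 ((hdeg ⟨0, by lia⟩).trans (hdle _))
  have hN : 0 < N := hm0.trans_le (Nat.cast_le.2 (le_coeffDim (by lia) deg))
  have hl : 0 < l := hm0.trans_le (le_logDim m hd)
  have hr : 0 < r := decayExponent_pos hnm
  have htail : ∀ t, 1 ≤ t → prob (t * M) ≤ 3 / t ^ r * tailFactor n m N l (r * Real.log t) :=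
    fun t => measureReal_condGlobal_le hn hnm hdeg hdle hX hind hK hc₀.le hsg hsb
  have hone : ∀ {A t : ℝ}, 0 < A → Real.exp (A / r) ≤ t → 1 ≤ t := fun hA h =>
    (Real.one_le_exp (by positivity)).trans h
  have hle : ∀ {A t : ℝ}, 1 ≤ t → t ≤ Real.exp (A / r) → r * Real.log t ≤ A := fun ht =>
    mul_log_le_of_le_exp_div hr (zero_lt_one.trans_le ht)
  have hge : ∀ {A t : ℝ}, Real.exp (A / r) ≤ t → A ≤ r * Real.log t := le_mul_log_of_exp_div_le hr
  refine ⟨fun hlN t => ⟨fun ht htl => ?_, fun hlt htN => ?_, fun hNt => ?_⟩,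
    fun hNl t => ⟨fun ht htN => ?_, fun hNt => ?_⟩⟩
  · simpa [tailFactor_eq_one hN hl ((hle ht htl).trans hlN) (hle ht htl)] using htail t ht
  · simpa only [tailFactor_eq_rpow hN (hle (hone hl hlt) htN) (hge hlt)] using
      htail t (hone hl hlt)
  · simpa only [tailFactor_eq_rpow_mul_rpow hN hl (hge hNt) (hlN.trans (hge hNt)), mul_assoc] using
      htail t (hone hN hNt)
  · simpa [tailFactor_eq_one hN hl (hle ht htN) ((hle ht htN).trans hNl)] using htail t ht
  · have ht := hone hN hNt
    refine (htail t ht).trans ?_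
    gcongr
    exact tailFactor_le_rpow hn hN hNl (hge hNt)
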